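/- Let $k$ be an algebraically closed field, let $n\ge 1$ and $d\ge 0$ be integers, and assume that $\operatorname{char} k=0$ or $\operatorname{char} k>d$. Let $S=k[[\alpha_1,\dots,\alpha_n]]$. For $a\in\mathbb{N}_0^n$ let $x^{[a]}\colon S\to k$ be the functional taking the coefficient of $\alpha^a$, and let $P_{\le d}$ be the vector space spanned by the $x^{[a]}$ with $a_1+\dots+a_n\le d$, equipped with the Zariski topology of an affine space. Say that $f\in P_{\le d}$ has degree $d$ if $f$ does not lie in the span of the $x^{[a]}$ with $a_1+\dots+a_n\le d-1$. For $f\in P_{\le d}$ and $\sigma\in S$ let $\sigma\lrcorner f$ be the functional $\tau\mapsto f(\tau\sigma)$, let $\operatorname{Ann}(f)=\{\sigma\in S : \sigma\lrcorner f=0\}$, and let $\operatorname{Apolar}(f)=S/\operatorname{Ann}(f)$; $f$ is called a dual socle generator of this algebra. A local $k$-algebra $(A,\mathfrak{m})$ is canonically graded if it is isomorphic as a $k$-algebra to its associated graded algebra $\operatorname{gr}A=\bigoplus_{i\ge 0}\mathfrak{m}^i/\mathfrak{m}^{i+1}$, and its socle degree is $\max\{i : \mathfrak{m}^i\neq 0\}$.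 Let $\mathcal{G}\subseteq P_{\le d}$ be the set of dual socle generators of canonically graded local algebras of socle degree $d$, that is, the set of those $f\in P_{\le d}$ for which $\operatorname{Apolar}(f)$ is local, canonically graded and of socle degree $d$. Then $\mathcal{G}$ is irreducible (in particular non-empty) and constructible, but in general it is neither open nor closed: 1. if $n=2$ and $d=5$, then $\mathcal{G}$ is not closed in $P_{\le d}$; moreover, it is not even closed in the set of elements of degree $d$: there is an $f\in P_{\le d}$ of degree $d$ which lies in the closure of $\mathcal{G}$ but not in $\mathcal{G}$; 2. if $n=2$ and $d\ge 9$, then $\mathcal{G}$ is not open in $P_{\le d}$. -/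

import Mathlib

noncomputable section

namespace CanonicallyGraded

section AssociatedGraded

variable (k : Type*) [Field k] (A : Type*) [CommRing A] [IsLocalRing A] [Algebra k A]

/-- Inside the Rees algebra `⨁ i, 𝔪 ^ i t ^ i` of the maximal ideal `𝔪` of `A`,
the ideal `⨁ i, 𝔪 ^ (i + 1) t ^ i`. -/
def reesShift : Ideal (reesAlgebra (IsLocalRing.maximalIdeal A)) where
  carrier := {p | ∀ i, (p : Polynomial A).coeff i ∈ IsLocalRing.maximalIdeal A ^ (i + 1)}
  add_mem' {p q} hp hq i := by
    simpa using Ideal.add_mem _ (hp i) (hq i)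
  zero_mem' i := by simp
  smul_mem' c p hp i := by
    rw [smul_eq_mul, MulMemClass.coe_mul, Polynomial.coeff_mul]
    refine Ideal.sum_mem _ fun x hx => ?_
    rw [← Finset.HasAntidiagonal.mem_antidiagonal.mp hx, add_assoc, pow_add]
    exact Ideal.mul_mem_mul (c.2 x.1) (hp x.2)

/-- The associated graded algebra `gr A = ⨁ i, 𝔪 ^ i / 𝔪 ^ (i + 1)` of a local ring `A`, realised
as the quotient of `⨁ i, 𝔪 ^ i t ^ i` by the ideal `⨁ i, 𝔪 ^ (i + 1) t ^ i`. -/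
abbrev Gr : Type _ := reesAlgebra (IsLocalRing.maximalIdeal A) ⧸ reesShift A

/-- A local `k`-algebra is canonically graded if it is isomorphic, as a `k`-algebra, to its
associated graded algebra. -/
def IsCanonicallyGraded : Prop := Nonempty (A ≃ₐ[k] Gr A)

/-- `d` is the socle degree of `A`: the largest `i` with `𝔪 ^ i ≠ 0`. -/
def HasSocleDegree (d : ℕ) : Prop :=
  IsGreatest {i : ℕ | IsLocalRing.maximalIdeal A ^ i ≠ ⊥} d

end AssociatedGraded

section Apolarity

variable (k : Type*) [Field k] (n : ℕ)

/-- The power series ring `S = k[[α₁, …, αₙ]]`. -/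
abbrev S : Type _ := MvPowerSeries (Fin n) k

/-- The divided power monomial `x^[a]`: the functional on `S` dual to the monomial `α ^ a`, that is,
the functional taking the coefficient of `α ^ a`. -/
def dpMonomial (a : Fin n →₀ ℕ) : Module.Dual k (S k n) := MvPowerSeries.coeff a

/-- The space `P_{≤ d}` of divided power polynomials of degree at most `d`: the span of
the `x^[a]` with `a₁ + ⋯ + aₙ ≤ d`. -/
def PLE (d : ℕ) : Submodule k (Module.Dual k (S k n)) :=
  Submodule.span k (dpMonomial k n '' {a | a.degree ≤ d})

variable {k n}

/-- The contraction `σ ⌟ f`, given by `⟨τ, σ ⌟ f⟩ = ⟨τ σ, f⟩`. -/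
def contract (σ : S k n) (f : Module.Dual k (S k n)) : Module.Dual k (S k n) :=
  f ∘ₗ LinearMap.mulRight k σ

/-- The apolar ideal `Ann f = {σ | σ ⌟ f = 0}`. -/
def Ann (f : Module.Dual k (S k n)) : Ideal (S k n) where
  carrier := {σ | contract σ f = 0}
  add_mem' {σ τ} hσ hτ := by
    have h : contract (σ + τ) f = contract σ f + contract τ f := by
      ext x; simp [contract, mul_add]
    rw [Set.mem_ofPred_eq, h, hσ, hτ, add_zero]
  zero_mem' := by ext x; simp [contract]
  smul_mem' c σ hσ := by
    ext x
    have h := LinearMap.congr_fun hσ (x * c)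
    simpa [contract, mul_assoc] using h

/-- The apolar algebra `S / Ann f`; `f` is a dual socle generator of it. -/
abbrev Apolar (f : Module.Dual k (S k n)) : Type _ := S k n ⧸ Ann f

end Apolarity

/-- The Zariski topology of a finite-dimensional vector space `V`, regarded as an affine space: the
non-vanishing loci of polynomial functions (polynomials in linear functionals) form a basis. -/
abbrev zariskiTopology (k : Type*) [Field k] (V : Type*) [AddCommGroup V] [Module k V] :
    TopologicalSpace V :=
  TopologicalSpace.generateFrom
    {U | ∃ p : MvPolynomial (Module.Dual k V) k,
      U = {v | MvPolynomial.eval (fun l : Module.Dual k V => l v) p ≠ 0}}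

instance instTopologicalSpacePLE (k : Type*) [Field k] (n d : ℕ) : TopologicalSpace (PLE k n d) :=
  zariskiTopology k (PLE k n d)

/-- The set of those `f ∈ P_{≤ d}` which are dual socle generators of canonically graded local
algebras of socle degree `d`. The zero ring, which is the apolar algebra of `0`, is not local. -/
def canGradedLocus (k : Type*) [Field k] (n d : ℕ) : Set (PLE k n d) :=
  {f | ∃ _ : IsLocalRing (Apolar (f : Module.Dual k (S k n))),
    IsCanonicallyGraded k (Apolar (f : Module.Dual k (S k n))) ∧
      HasSocleDegree (Apolar (f : Module.Dual k (S k n))) d}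

end CanonicallyGraded

end

noncomputable section

namespace CanonicallyGraded

open MvPowerSeries IsLocalRing

/-! ### Powers of the maximal ideal and homogeneous components of power series -/

section PowerSeries

variable {k : Type*} [Field k] {n : ℕ}

/-! The locus consists exactly of the twisted forms `s ↦ F (u * φ s)`, with `F ≠ 0` homogeneous of
degree `d`, `u` a unit and `φ` a formal change of coordinates (`mem_canGradedLocus_iff`).

If the apolar algebra `A` of `f` is isomorphic to `gr A`, then `A` has a second presentation by `S`
with homogeneous kernel. Pulling the functional back along it gives `h`, whose degree-`d` part kills
this kernel and is therefore a contraction `u ⌟ h`, with `u` a unit. Comparing the two presentations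
supplies the coordinate change. Conversely, `Ann F` is homogeneous, and the twist only replaces the
apolar algebra by an isomorphic one.

Only finitely many coefficients of `u`, `F` and `φ` matter, so the locus is a finite union of images
of principal open sets of one affine space under one polynomial map. Chevalley's theorem makes it
constructible; irreducibility holds because the polynomial ring of parameters is a domain.

For the negative statements, `x^[d] + t y^[d-1]` with `t ≠ 0` and `d ≥ 3` is not a twisted form
(`not_isTwistedForm_add_smul`). For `t = 1` it is a limit of the twisted forms `x^[d] + y^[d-1] + s
y^[d]` as `s → 0`, so the locus is not closed; as `t → 0` it tends to the twisted form `x^[d]`, so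
the locus is not open. -/

theorem mem_maximalIdeal_iff {s : S k n} : s ∈ maximalIdeal (S k n) ↔ constantCoeff s = 0 := by
  rw [mem_maximalIdeal, mem_nonunits_iff, isUnit_iff_constantCoeff, isUnit_iff_ne_zero, not_not]

theorem X_mem_maximalIdeal (i : Fin n) : (X i : S k n) ∈ maximalIdeal (S k n) := by
  rw [mem_maximalIdeal_iff, constantCoeff_X]

theorem coeff_eq_zero_of_mem_maximalIdeal_pow {j : ℕ} {s : S k n}
    (hs : s ∈ maximalIdeal (S k n) ^ j) {a : Fin n →₀ ℕ} (ha : a.degree < j) :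
    coeff a s = 0 := by
  induction j generalizing s a with
  | zero => omega
  | succ j ih =>
    rw [pow_succ] at hs
    refine Submodule.mul_induction_on hs (fun x hx y hy => ?_) fun x y hx hy => by
      rw [map_add, hx, hy, add_zero]
    rw [coeff_mul]
    refine Finset.sum_eq_zero fun p hp => ?_
    rw [Finset.HasAntidiagonal.mem_antidiagonal] at hp
    by_cases h : p.2 = 0
    · rw [h, coeff_zero_eq_constantCoeff_apply, mem_maximalIdeal_iff.1 hy, mul_zero]
    · rw [ih hx, zero_mul]
      have : 0 < p.2.degree := Nat.pos_of_ne_zero fun h' => h ((Finsupp.degree_eq_zero_iff _).1 h')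
      rw [← hp, map_add] at ha
      omega

/-- Every power series without constant term is a combination of the variables, with coefficients
whose order is one less. -/
theorem exists_eq_sum_X_mul {j : ℕ} {s : S k n} (hs : ∀ a, a.degree < j + 1 → coeff a s = 0) :
    ∃ q : Fin n → S k n, s = ∑ i, X i * q i ∧ ∀ i a, a.degree < j → coeff a (q i) = 0 := by
  classical
  -- Each nonzero exponent is assigned to one variable occurring in it, so that every monomial is
  -- divided exactly once.
  let pick : (Fin n →₀ ℕ) → Option (Fin n) := fun b =>
    if h : ∃ i, b i ≠ 0 then some h.choose else none
  have pick_spec : ∀ b i, pick b = some i → b i ≠ 0 := by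
    intro b i h
    by_cases hb : ∃ i, b i ≠ 0
    · simp only [pick, dif_pos hb, Option.some.injEq] at h
      exact h ▸ hb.choose_spec
    · simp [pick, dif_neg hb] at h
  let part : Fin n → S k n := fun i b => if pick b = some i then coeff b s else 0
  have hpart : ∀ i b, coeff b (part i) = if pick b = some i then coeff b s else 0 := fun _ _ => rfl
  have hdvd : ∀ i, (X i : S k n) ∣ part i := by
    intro i
    rw [X_dvd_iff]
    intro m hm
    rw [hpart, if_neg fun h => pick_spec _ _ h hm]
  choose q hq using hdvd
  refine ⟨q, ?_, fun i a ha => ?_⟩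
  · simp_rw [← hq]
    ext b
    rw [map_sum]
    simp_rw [hpart]
    by_cases hb : ∃ i, b i ≠ 0
    · simp [pick, dif_pos hb]
    · have : b = 0 := by ext i; by_contra h; exact hb ⟨i, h⟩
      rw [hs b (by simp [this])]
      simp
  · have h1 : coeff (Finsupp.single i 1 + a) (part i) = coeff a (q i) := by
      rw [hq, X, coeff_add_monomial_mul, one_mul]
    rw [← h1, hpart, hs, ite_self]
    rw [map_add, Finsupp.degree_single]
    omega

theorem mem_maximalIdeal_pow_iff {j : ℕ} {s : S k n} :
    s ∈ maximalIdeal (S k n) ^ j ↔ ∀ a : Fin n →₀ ℕ, a.degree < j → coeff a s = 0 := by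
  refine ⟨fun hs a ha => coeff_eq_zero_of_mem_maximalIdeal_pow hs ha, fun hs => ?_⟩
  induction j generalizing s with
  | zero => simp
  | succ j ih =>
    obtain ⟨q, hq, hq'⟩ := exists_eq_sum_X_mul hs
    rw [hq, pow_succ']
    exact Ideal.sum_mem _ fun i _ => Ideal.mul_mem_mul (X_mem_maximalIdeal i) (ih (hq' i))

theorem maximalIdeal_eq_span : maximalIdeal (S k n) = Ideal.span (Set.range X) := by
  refine le_antisymm (fun s hs => ?_) (Ideal.span_le.2 ?_)
  · obtain ⟨q, hq, -⟩ := exists_eq_sum_X_mul (j := 0) (s := s)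
      fun a ha => coeff_eq_zero_of_mem_maximalIdeal_pow (by simpa using hs) ha
    rw [hq]
    exact Ideal.sum_mem _ fun i _ => Ideal.mul_mem_right _ _ (Ideal.subset_span ⟨i, rfl⟩)
  · rintro _ ⟨i, rfl⟩
    exact X_mem_maximalIdeal i

theorem homogeneousComponent_mem (j : ℕ) (s : S k n) :
    homogeneousComponent j s ∈ maximalIdeal (S k n) ^ j := by
  rw [mem_maximalIdeal_pow_iff]
  intro a ha
  rw [coeff_homogeneousComponent, if_neg ha.ne]

theorem homogeneousComponent_eq_zero_of_mem {i j : ℕ} (hij : i < j) {s : S k n}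
    (hs : s ∈ maximalIdeal (S k n) ^ j) : homogeneousComponent i s = 0 := by
  ext a
  rw [coeff_homogeneousComponent]
  split_ifs with h
  · rw [coeff_eq_zero_of_mem_maximalIdeal_pow hs (h ▸ hij), map_zero]
  · simp

theorem homogeneousComponent_homogeneousComponent (i j : ℕ) (s : S k n) :
    homogeneousComponent i (homogeneousComponent j s) =
      if i = j then homogeneousComponent j s else 0 := by
  ext a
  rw [coeff_homogeneousComponent]
  split_ifs with h h' h'
  · rfl
  · rw [coeff_homogeneousComponent, if_neg (by omega), map_zero]
  · rw [coeff_homogeneousComponent, if_neg (by omega)]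
  · simp

theorem homogeneousComponent_mul (j : ℕ) (s t : S k n) :
    homogeneousComponent j (s * t) =
      ∑ p ∈ Finset.HasAntidiagonal.antidiagonal j, homogeneousComponent p.1 s * homogeneousComponent p.2 t := by
  classical
  ext a
  rw [coeff_homogeneousComponent, map_sum]
  simp_rw [coeff_mul, coeff_homogeneousComponent]
  rw [Finset.sum_comm]
  split_ifs with h
  · refine Finset.sum_congr rfl fun q hq => ?_
    rw [Finset.HasAntidiagonal.mem_antidiagonal] at hq
    rw [Finset.sum_eq_single (q.1.degree, q.2.degree)]
    · simp
    · rintro ⟨i, l⟩ - hne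
      by_cases h1 : q.1.degree = i
      · rw [if_neg (c := q.2.degree = l) fun h2 => hne (by rw [h1, h2]), mul_zero]
      · rw [if_neg h1, zero_mul]
    · intro hn
      exact absurd (Finset.HasAntidiagonal.mem_antidiagonal.2 (by rw [← h, ← hq, map_add])) hn
  · symm
    refine Finset.sum_eq_zero fun q hq => Finset.sum_eq_zero fun p hp => ?_
    rw [Finset.HasAntidiagonal.mem_antidiagonal] at hq hp
    by_cases h1 : q.1.degree = p.1
    · rw [if_neg (c := q.2.degree = p.2), mul_zero]
      intro h2
      exact h (by rw [← hq, map_add, h1, h2, hp])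
    · rw [if_neg h1, zero_mul]

theorem sub_sum_homogeneousComponent_mem (j : ℕ) (s : S k n) :
    s - ∑ i ∈ Finset.range j, homogeneousComponent i s ∈ maximalIdeal (S k n) ^ j := by
  rw [mem_maximalIdeal_pow_iff]
  intro a ha
  rw [map_sub, map_sum]
  simp_rw [coeff_homogeneousComponent]
  simp [ha]

/-- The homogeneous component of degree one, written out in the variables. -/
theorem sub_sum_linear_mem {s : S k n} (hs : s ∈ maximalIdeal (S k n)) :
    s - ∑ i, (coeff (Finsupp.single i 1) s) • (X i : S k n) ∈ maximalIdeal (S k n) ^ 2 := by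
  rw [mem_maximalIdeal_pow_iff]
  intro a ha
  rw [map_sub, map_sum]
  simp_rw [coeff_smul]
  obtain h | h : a.degree = 0 ∨ a.degree = 1 := by omega
  · rw [Finsupp.degree_eq_zero_iff] at h
    subst h
    rw [coeff_zero_eq_constantCoeff_apply, mem_maximalIdeal_iff.1 hs]
    simp
  · obtain ⟨i, rfl⟩ : ∃ i, a = Finsupp.single i 1 := by
      obtain ⟨i, hi⟩ : ∃ i, a i ≠ 0 := by
        by_contra! h0
        rw [show a = 0 from Finsupp.ext h0] at h
        simp at h
      obtain ⟨c, rfl⟩ := le_iff_exists_add.1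
        (Finsupp.single_le_iff.2 (Nat.one_le_iff_ne_zero.2 hi))
      rw [map_add, Finsupp.degree_single, add_eq_left, Finsupp.degree_eq_zero_iff] at h
      exact ⟨i, by rw [h, add_zero]⟩
    classical
    simp [coeff_X, Finsupp.single_left_inj]

end PowerSeries

/-! ### Divided power polynomials as functionals killing a power of the maximal ideal -/

section Functionals

variable {k : Type*} [Field k] {n : ℕ}

/-- The exponents of degree at most `d`. -/
abbrev Exponent (n d : ℕ) : Type := {a : Fin n →₀ ℕ // a.degree ≤ d}

instance (n d : ℕ) : Finite (Exponent n d) := Finsupp.finite_of_degree_le d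

instance (n d : ℕ) : Fintype (Exponent n d) := Fintype.ofFinite _

theorem sub_sum_monomial_mem (d : ℕ) (s : S k n) :
    s - ∑ a : Exponent n d, coeff a.1 s • (monomial a.1 1 : S k n) ∈
      maximalIdeal (S k n) ^ (d + 1) := by
  classical
  rw [mem_maximalIdeal_pow_iff]
  intro a ha
  rw [map_sub, map_sum, Finset.sum_eq_single (⟨a, by omega⟩ : Exponent n d)]
  · simp
  · intro b _ hb
    rw [coeff_smul, coeff_monomial, if_neg, mul_zero]
    rintro rfl
    exact hb rfl
  · simp

theorem apply_eq_zero_of_mem_PLE {d : ℕ} {f : Module.Dual k (S k n)} (hf : f ∈ PLE k n d)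
    {s : S k n} (hs : s ∈ maximalIdeal (S k n) ^ (d + 1)) : f s = 0 := by
  induction hf using Submodule.span_induction with
  | mem x h =>
    obtain ⟨a, ha, rfl⟩ := h
    exact coeff_eq_zero_of_mem_maximalIdeal_pow hs (Nat.lt_succ_of_le ha)
  | zero => rfl
  | add x y _ _ hx hy => rw [LinearMap.add_apply, hx, hy, add_zero]
  | smul c x _ hx => rw [LinearMap.smul_apply, hx, smul_zero]

theorem apply_eq_sum {d : ℕ} {f : Module.Dual k (S k n)}
    (hf : ∀ s ∈ maximalIdeal (S k n) ^ (d + 1), f s = 0) (s : S k n) :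
    f s = ∑ a : Exponent n d, coeff a.1 s * f (monomial a.1 1) := by
  have h := hf _ (sub_sum_monomial_mem d s)
  rw [map_sub, sub_eq_zero] at h
  rw [h, map_sum]
  simp_rw [map_smul, smul_eq_mul]

/-- The monomials of degree at most `d` span `S` modulo `𝔪 ^ (d + 1)`. This form of membership needs
no coordinates and so survives changes of presentation. -/
theorem mem_PLE_iff {d : ℕ} {f : Module.Dual k (S k n)} :
    f ∈ PLE k n d ↔ ∀ s ∈ maximalIdeal (S k n) ^ (d + 1), f s = 0 := by
  refine ⟨fun hf s hs => apply_eq_zero_of_mem_PLE hf hs, fun hf => ?_⟩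
  have : f = ∑ a : Exponent n d, f (monomial a.1 1) • dpMonomial k n a.1 := by
    ext s
    rw [apply_eq_sum hf, LinearMap.sum_apply]
    exact Finset.sum_congr rfl fun a _ => mul_comm _ _
  rw [this]
  exact Submodule.sum_mem _ fun a _ => Submodule.smul_mem _ _ (Submodule.subset_span ⟨a.1, a.2, rfl⟩)

theorem PLE_ext {d : ℕ} {f g : Module.Dual k (S k n)} (hf : f ∈ PLE k n d) (hg : g ∈ PLE k n d)
    (h : ∀ a : Exponent n d, f (monomial a.1 1) = g (monomial a.1 1)) : f = g := by
  ext s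
  rw [apply_eq_sum (mem_PLE_iff.1 hf), apply_eq_sum (mem_PLE_iff.1 hg)]
  simp_rw [h]

theorem mem_Ann {f : Module.Dual k (S k n)} {s : S k n} : s ∈ Ann f ↔ ∀ t, f (t * s) = 0 :=
  ⟨fun h t => LinearMap.congr_fun h t, fun h => LinearMap.ext h⟩

theorem maximalIdeal_pow_le_Ann {d : ℕ} {f : Module.Dual k (S k n)} (hf : f ∈ PLE k n d) :
    maximalIdeal (S k n) ^ (d + 1) ≤ Ann f :=
  fun _ hs => mem_Ann.2 fun _ => mem_PLE_iff.1 hf _ (Ideal.mul_mem_left _ _ hs)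

end Functionals

/-! ### Presenting the associated graded algebra -/

section LocalAlgebra

variable {k : Type*} [Field k] {n : ℕ} {A : Type*} [CommRing A] [IsLocalRing A] [Algebra k A]
  {π : S k n →ₐ[k] A}

theorem map_maximalIdeal_pow (hπ : Function.Surjective π) (j : ℕ) :
    (maximalIdeal (S k n) ^ j).map π = maximalIdeal A ^ j := by
  rw [Ideal.map_pow]
  congr 1
  exact map_maximalIdeal_of_surjective (π : S k n →+* A) hπ

theorem map_mem_maximalIdeal_pow (hπ : Function.Surjective π) {j : ℕ} {s : S k n}
    (hs : s ∈ maximalIdeal (S k n) ^ j) : π s ∈ maximalIdeal A ^ j :=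
  map_maximalIdeal_pow hπ j ▸ Ideal.mem_map_of_mem _ hs

theorem exists_of_mem_maximalIdeal_pow (hπ : Function.Surjective π) {j : ℕ} {x : A}
    (hx : x ∈ maximalIdeal A ^ j) : ∃ s ∈ maximalIdeal (S k n) ^ j, π s = x := by
  rw [← map_maximalIdeal_pow hπ] at hx
  exact (Ideal.mem_map_iff_of_surjective π hπ).1 hx

/-- A presentation of a local algebra `A` with `𝔪 ^ (d + 1) = 0` by a power series ring gives one of
its associated graded algebra. -/
theorem exists_gr_presentation (hπ : Function.Surjective π) {d : ℕ}
    (hd : maximalIdeal A ^ (d + 1) = ⊥) :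
    ∃ Θ : S k n →ₐ[k] Gr A, Function.Surjective Θ ∧
      ∀ s, Θ s = 0 ↔ ∀ j, π (homogeneousComponent j s) ∈ maximalIdeal A ^ (j + 1) := by
  have hbot : ∀ j, d < j → maximalIdeal A ^ j = ⊥ := fun j hj =>
    le_bot_iff.1 (hd ▸ Ideal.pow_le_pow_right hj)
  -- A series may have infinitely many components, but those of degree above `d` map to zero in `A`,
  -- so the truncation loses nothing.
  let P : S k n → Polynomial A := fun s =>
    ∑ j ∈ Finset.range (d + 1), Polynomial.monomial j (π (homogeneousComponent j s))
  have hP : ∀ s j, (P s).coeff j = π (homogeneousComponent j s) := by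
    intro s j
    simp only [P, Polynomial.finsetSum_coeff, Polynomial.coeff_monomial]
    rw [Finset.sum_ite_eq']
    split_ifs with h
    · rfl
    · have h1 := map_mem_maximalIdeal_pow hπ (homogeneousComponent_mem j s)
      rw [hbot j (by simpa using h), Ideal.mem_bot] at h1
      exact h1.symm
  have hmem : ∀ s, P s ∈ reesAlgebra (maximalIdeal A) := by
    intro s
    rw [mem_reesAlgebra_iff]
    intro j
    rw [hP]
    exact map_mem_maximalIdeal_pow hπ (homogeneousComponent_mem j s)
  have hone : P 1 = 1 := by
    ext j
    rw [hP, Polynomial.coeff_one]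
    split_ifs with h
    · rw [← map_one π]
      congr 1
      ext a
      rw [coeff_homogeneousComponent, coeff_one]
      split_ifs with h1 h2 h2
      · rfl
      · rfl
      · subst h2; exact absurd (by simp [h]) h1
      · rfl
    · rw [← map_zero π]
      congr 1
      ext a
      rw [coeff_homogeneousComponent, coeff_one]
      split_ifs with h1 h2
      · subst h2; exact absurd (by simpa using h1.symm) h
      · simp
      · simp
  have hmul : ∀ s t, P (s * t) = P s * P t := by
    intro s t
    ext j
    rw [hP, homogeneousComponent_mul, map_sum, Polynomial.coeff_mul]
    simp_rw [hP, map_mul]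
  let Q : S k n →ₗ[k] reesAlgebra (maximalIdeal A) :=
    { toFun := fun s => ⟨P s, hmem s⟩
      map_add' := fun s t => by
        ext j
        simp [hP]
      map_smul' := fun c s => by
        ext j
        simp [hP] }
  let Ψ : S k n →ₐ[k] reesAlgebra (maximalIdeal A) :=
    AlgHom.ofLinearMap Q (Subtype.ext hone) fun s t => Subtype.ext (hmul s t)
  have hΨ : ∀ s j, (Ψ s : Polynomial A).coeff j = π (homogeneousComponent j s) := hP
  refine ⟨(Ideal.Quotient.mkₐ k (reesShift A)).comp Ψ, ?_, ?_⟩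
  · intro y
    obtain ⟨p, rfl⟩ := Ideal.Quotient.mk_surjective y
    have : ∀ j, ∃ s ∈ maximalIdeal (S k n) ^ j, π s = (p : Polynomial A).coeff j := fun j =>
      exists_of_mem_maximalIdeal_pow hπ ((mem_reesAlgebra_iff _ _).1 p.2 j)
    choose s hs hsp using this
    -- Only the leading component of each lift is needed: the rest has order at least `i + 1` and
    -- dies in the graded quotient.
    refine ⟨∑ i ∈ Finset.range (d + 1), homogeneousComponent i (s i), ?_⟩
    refine (Ideal.Quotient.eq (I := reesShift A)).2 fun j => ?_
    rw [AddSubgroupClass.coe_sub, Polynomial.coeff_sub]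
    change (Ψ (∑ i ∈ Finset.range (d + 1), homogeneousComponent i (s i)) : Polynomial A).coeff j -
      (p : Polynomial A).coeff j ∈ _
    rw [hΨ, map_sum]
    simp_rw [homogeneousComponent_homogeneousComponent]
    rw [Finset.sum_ite_eq]
    split_ifs with hj
    · rw [← hsp, ← map_sub]
      refine map_mem_maximalIdeal_pow hπ ?_
      rw [← neg_mem_iff, neg_sub]
      have h1 := sub_sum_homogeneousComponent_mem (j + 1) (s j)
      rwa [Finset.sum_range_succ, Finset.sum_eq_zero, zero_add] at h1
      intro i hi
      exact homogeneousComponent_eq_zero_of_mem (Finset.mem_range.1 hi) (hs j)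
    · have h1 := (mem_reesAlgebra_iff _ _).1 p.2 j
      rw [hbot j (by simpa using hj), Ideal.mem_bot] at h1
      rw [h1, map_zero, sub_zero]
      exact zero_mem _
  · intro s
    rw [AlgHom.comp_apply]
    refine (Ideal.Quotient.eq_zero_iff_mem (I := reesShift A)).trans ?_
    exact forall_congr' fun j => by rw [hΨ]

end LocalAlgebra

/-! ### From canonically graded algebras to twisted forms -/

section LinearAlgebra

/-- Two linear maps from a finite-dimensional space with the same range differ by an automorphism of
the source. -/
theorem exists_equiv_of_range_eq {K V W : Type*} [Field K] [AddCommGroup V] [Module K V]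
    [AddCommGroup W] [Module K W] [FiniteDimensional K V] {p q : V →ₗ[K] W}
    (h : LinearMap.range p = LinearMap.range q) : ∃ e : V ≃ₗ[K] V, ∀ v, p v = q (e v) := by
  -- The kernels have equal dimension and are matched arbitrarily; their complements are matched
  -- through the common range.
  obtain ⟨C, hC⟩ := (LinearMap.ker p).exists_isCompl
  obtain ⟨D, hD⟩ := (LinearMap.ker q).exists_isCompl
  have hker : Module.finrank K (LinearMap.ker p) = Module.finrank K (LinearMap.ker q) := by
    have h1 := p.finrank_range_add_finrank_ker
    have h2 := q.finrank_range_add_finrank_ker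
    rw [h] at h1
    omega
  let e₁ := LinearEquiv.ofFinrankEq _ _ hker
  let e₂ : C ≃ₗ[K] D := (p.kerComplementEquivRange hC.symm).trans
    ((LinearEquiv.ofEq _ _ h).trans (q.kerComplementEquivRange hD.symm).symm)
  have he₂ : ∀ c : C, q (e₂ c) = p c := by
    intro c
    have h1 : q.kerComplementEquivRange hD.symm (e₂ c) =
        LinearEquiv.ofEq _ _ h (p.kerComplementEquivRange hC.symm c) :=
      LinearEquiv.apply_symm_apply _ _
    exact congrArg Subtype.val h1
  refine ⟨(Submodule.prodEquivOfIsCompl _ _ hC).symm.trans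
    ((e₁.prodCongr e₂).trans (Submodule.prodEquivOfIsCompl _ _ hD)), fun v => ?_⟩
  obtain ⟨⟨x, c⟩, rfl⟩ := (Submodule.prodEquivOfIsCompl _ _ hC).surjective v
  simp [he₂]

end LinearAlgebra

section

variable {k : Type*} [Field k] {n : ℕ}

section LocalAlgebra

variable {A : Type*} [CommRing A] [IsLocalRing A] [Algebra k A]

theorem exists_linear_of_mem_maximalIdeal {π : S k n →ₐ[k] A} (hπ : Function.Surjective π) {x : A}
    (hx : x ∈ maximalIdeal A) :
    ∃ c : Fin n → k, x - ∑ i, c i • π (X i) ∈ maximalIdeal A ^ 2 := by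
  obtain ⟨s, hs, rfl⟩ := exists_of_mem_maximalIdeal_pow (j := 1) hπ (by simpa using hx)
  rw [pow_one] at hs
  refine ⟨fun i => coeff (Finsupp.single i 1) s, ?_⟩
  have := map_mem_maximalIdeal_pow hπ (sub_sum_linear_mem hs)
  simpa [map_sum] using this

/-- Two presentations of a local algebra differ, modulo `𝔪 ^ 2`, by an invertible matrix. -/
theorem exists_matrix {π ρ : S k n →ₐ[k] A} (hπ : Function.Surjective π)
    (hρ : Function.Surjective ρ) :
    ∃ M : Matrix (Fin n) (Fin n) k, M.det ≠ 0 ∧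
      ∀ i, π (X i) - ∑ j, M i j • ρ (X j) ∈ maximalIdeal A ^ 2 := by
  let N : Submodule k A := (maximalIdeal A ^ 2).restrictScalars k
  let L : (S k n →ₐ[k] A) → (Fin n → k) →ₗ[k] A ⧸ N := fun σ =>
    N.mkQ ∘ₗ Fintype.linearCombination k fun i => σ (X i)
  have hL : ∀ σ c, L σ c = N.mkQ (∑ i, c i • σ (X i)) := fun σ c => by
    simp only [L, LinearMap.comp_apply, Fintype.linearCombination_apply]
  have key : ∀ σ τ : S k n →ₐ[k] A, Function.Surjective σ → Function.Surjective τ →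
      LinearMap.range (L σ) ≤ LinearMap.range (L τ) := by
    rintro σ τ hσ hτ _ ⟨c, rfl⟩
    have hmem : ∑ i, c i • σ (X i) ∈ maximalIdeal A := by
      refine Ideal.sum_mem _ fun i _ => Submodule.smul_of_tower_mem _ _ ?_
      simpa using map_mem_maximalIdeal_pow hσ (j := 1) (by simpa using X_mem_maximalIdeal i)
    obtain ⟨c', hc'⟩ := exists_linear_of_mem_maximalIdeal hτ hmem
    refine ⟨c', ?_⟩
    rw [hL, hL]
    exact ((Submodule.Quotient.eq N).2 hc').symm
  -- The images of the variables may be dependent modulo `𝔪 ^ 2`, so the matrix is not unique;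
  -- invertibility has to be arranged.
  obtain ⟨e, he⟩ := exists_equiv_of_range_eq (le_antisymm (key π ρ hπ hρ) (key ρ π hρ hπ))
  refine ⟨(LinearMap.toMatrix' (e : (Fin n → k) →ₗ[k] Fin n → k)).transpose, ?_, fun i => ?_⟩
  · rw [Matrix.det_transpose, LinearMap.det_toMatrix']
    exact (LinearEquiv.isUnit_det' e).ne_zero
  · have h1 := he (Pi.single i 1)
    rw [hL, hL] at h1
    have h2 := (Submodule.Quotient.eq N).1 h1
    simpa [Pi.single_apply, LinearMap.toMatrix'_apply, N] using h2

end LocalAlgebra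

theorem finite_quotient {d : ℕ} {J : Ideal (S k n)} (hJ : maximalIdeal (S k n) ^ (d + 1) ≤ J) :
    Module.Finite k (S k n ⧸ J) := by
  classical
  refine ⟨⟨Finset.univ.image fun a : Exponent n d => Ideal.Quotient.mk J (monomial a.1 1), ?_⟩⟩
  rw [eq_top_iff]
  rintro x -
  obtain ⟨s, rfl⟩ := Ideal.Quotient.mk_surjective x
  rw [Ideal.Quotient.eq.2 (hJ (sub_sum_monomial_mem d s)), map_sum]
  refine Submodule.sum_mem _ fun a _ => ?_
  have : Ideal.Quotient.mk J (coeff a.1 s • (monomial a.1 1 : S k n)) =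
      coeff a.1 s • Ideal.Quotient.mk J (monomial a.1 1) := rfl
  rw [this]
  exact Submodule.smul_mem _ _ (Submodule.subset_span (by simp))

/-- Functionals vanishing on the apolar ideal of `h` are contractions of `h`. -/
theorem exists_eq_contract {d : ℕ} {h F : Module.Dual k (S k n)} (hh : h ∈ PLE k n d)
    (hF : ∀ s ∈ Ann h, F s = 0) : ∃ u, ∀ s, F s = h (u * s) := by
  have := finite_quotient (maximalIdeal_pow_le_Ann hh)
  let C := S k n ⧸ Ann h
  let N : Submodule k (S k n) := (Ann h).restrictScalars k
  have hN : ∀ s ∈ N, h s = 0 := fun s hs => by simpa using mem_Ann.1 hs 1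
  let hC : C →ₗ[k] k := N.liftQ h fun s hs => hN s hs
  let FC : C →ₗ[k] k := N.liftQ F fun s hs => hF s hs
  -- This pairing is nondegenerate by the very definition of `Ann h`; in finite dimension every
  -- functional on the quotient is then a contraction.
  let B : C →ₗ[k] Module.Dual k C := (LinearMap.mul k C).compr₂ hC
  have hB : Function.Injective B := by
    rw [injective_iff_map_eq_zero]
    intro x hx
    obtain ⟨s, rfl⟩ := Ideal.Quotient.mk_surjective x
    refine Ideal.Quotient.eq_zero_iff_mem.2 (mem_Ann.2 fun t => ?_)
    rw [mul_comm]
    exact LinearMap.congr_fun hx (Ideal.Quotient.mk _ t)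
  have hB' : Function.Surjective B :=
    (LinearMap.injective_iff_surjective_of_finrank_eq_finrank Subspace.dual_finrank_eq.symm).1 hB
  obtain ⟨x, hx⟩ := hB' FC
  obtain ⟨u, rfl⟩ := Ideal.Quotient.mk_surjective x
  exact ⟨u, fun s => (LinearMap.congr_fun hx (Ideal.Quotient.mk _ s)).symm⟩

/-- `f` is obtained from a nonzero homogeneous functional `F` of degree `d` by multiplication by a
unit and a formal change of coordinates. -/
def IsTwistedForm (d : ℕ) (f : Module.Dual k (S k n)) : Prop :=
  ∃ (u : S k n) (b : Fin n → S k n) (F : Module.Dual k (S k n)),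
    constantCoeff u ≠ 0 ∧ (∀ i, constantCoeff (b i) = 0) ∧
    (Matrix.of fun i j => coeff (Finsupp.single j 1) (b i)).det ≠ 0 ∧
    (∀ s, F s = F (homogeneousComponent d s)) ∧ F ≠ 0 ∧
    ∀ a : Fin n →₀ ℕ, a.degree ≤ d → f (monomial a 1) = F (u * ∏ i, b i ^ a i)

theorem monomial_one_eq_prod (a : Fin n →₀ ℕ) :
    (monomial a 1 : S k n) = ∏ i, X i ^ a i := by
  rw [monomial_one_eq, Finsupp.prod_fintype]
  simp

/-- The presentation `ρ` through `gr A` has a kernel stable under taking degree-`d` components, and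
this kernel is `Ann h` for the pulled-back functional `h`. So the degree-`d` part of `h` is `u ⌟ h`.
It agrees with `h` on `𝔪 ^ d`, where `h` is nonzero, which forces `u` to be a unit. Hence `h` is the
contraction of its top form by `u⁻¹`. -/
theorem isTwistedForm_of_algEquiv_gr {d : ℕ} {f : Module.Dual k (S k n)}
    [IsLocalRing (Apolar f)] (hgr : IsCanonicallyGraded k (Apolar f))
    (hd : HasSocleDegree (Apolar f) d) : IsTwistedForm d f := by
  classical
  obtain ⟨ψ⟩ := hgr
  have hd1 : maximalIdeal (Apolar f) ^ (d + 1) = ⊥ := by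
    by_contra h
    exact absurd (hd.2 h) (by omega)
  let π : S k n →ₐ[k] Apolar f := Ideal.Quotient.mkₐ k (Ann f)
  have hπ : Function.Surjective π := Ideal.Quotient.mk_surjective
  obtain ⟨Θ, hΘ, hΘ0⟩ := exists_gr_presentation hπ hd1
  let ρ : S k n →ₐ[k] Apolar f := (ψ.symm : Gr (Apolar f) →ₐ[k] Apolar f).comp Θ
  have hρ : Function.Surjective ρ := ψ.symm.surjective.comp hΘ
  have hρ0 : ∀ s, ρ s = 0 ↔
      ∀ j, π (homogeneousComponent j s) ∈ maximalIdeal (Apolar f) ^ (j + 1) := fun s => by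
    rw [← hΘ0]
    exact map_eq_zero_iff ψ.symm ψ.symm.injective
  have hρhom : ∀ s, ρ s = 0 → ρ (homogeneousComponent d s) = 0 := by
    intro s hs
    rw [hρ0] at hs ⊢
    intro j
    rw [homogeneousComponent_homogeneousComponent]
    split_ifs with h
    · exact h ▸ hs j
    · simp
  let N : Submodule k (S k n) := (Ann f).restrictScalars k
  let fA : Apolar f →ₗ[k] k := N.liftQ f fun s hs => by simpa using mem_Ann.1 hs 1
  have hfA : ∀ s, fA (π s) = f s := fun _ => rfl
  have hnd : ∀ x : Apolar f, (∀ y, fA (y * x) = 0) → x = 0 := by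
    intro x hx
    obtain ⟨s, rfl⟩ := hπ x
    refine Ideal.Quotient.eq_zero_iff_mem.2 (mem_Ann.2 fun t => ?_)
    rw [← hfA, map_mul]
    exact hx _
  let h : Module.Dual k (S k n) := fA ∘ₗ ρ.toLinearMap
  have hh : ∀ s, h s = fA (ρ s) := fun _ => rfl
  have hker : ∀ s, s ∈ Ann h ↔ ρ s = 0 := by
    intro s
    rw [mem_Ann]
    refine ⟨fun hs => hnd _ fun y => ?_, fun hs t => by rw [hh, map_mul, hs, mul_zero, map_zero]⟩
    obtain ⟨t, rfl⟩ := hρ y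
    rw [← map_mul]
    exact hs t
  have hhP : h ∈ PLE k n d := by
    rw [mem_PLE_iff]
    intro s hs
    have h1 := map_mem_maximalIdeal_pow hρ hs
    rw [hd1, Ideal.mem_bot] at h1
    rw [hh, h1, map_zero]
  obtain ⟨u, hu⟩ := exists_eq_contract (F := h ∘ₗ homogeneousComponent d) hhP fun s hs => by
    rw [hker] at hs
    rw [LinearMap.comp_apply, hh, hρhom s hs, map_zero]
  obtain ⟨w, hw, hw0⟩ : ∃ w ∈ maximalIdeal (S k n) ^ d, h w ≠ 0 := by
    obtain ⟨x, hx, hx0⟩ := Submodule.exists_mem_ne_zero_of_ne_bot hd.1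
    obtain ⟨s, hs, rfl⟩ := exists_of_mem_maximalIdeal_pow hρ hx
    by_contra! hcon
    exact hx0 ((hker s).1 (mem_Ann.2 fun t => hcon _ (Ideal.mul_mem_left _ _ hs)))
  have hFw : h (homogeneousComponent d w) = h w := by
    have h1 := sub_sum_homogeneousComponent_mem (d + 1) w
    rw [Finset.sum_range_succ, Finset.sum_eq_zero, zero_add] at h1
    · have h2 := mem_PLE_iff.1 hhP _ h1
      rwa [map_sub, sub_eq_zero, eq_comm] at h2
    · intro i hi
      exact homogeneousComponent_eq_zero_of_mem (Finset.mem_range.1 hi) hw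
  have hu0 : constantCoeff u ≠ 0 := by
    intro h0
    have h1 : u * w ∈ maximalIdeal (S k n) ^ (d + 1) := by
      rw [pow_succ']
      exact Ideal.mul_mem_mul (mem_maximalIdeal_iff.2 h0) hw
    have h2 := hu w
    rw [mem_PLE_iff.1 hhP _ h1, LinearMap.comp_apply, hFw] at h2
    exact hw0 h2
  obtain ⟨M, hM, hMX⟩ := exists_matrix hπ hρ
  -- Lifting the error of the linear comparison to order two makes `ρ` send the new coordinates
  -- exactly to `π (X i)`, with linear part still `M`.
  have : ∀ i, ∃ s ∈ maximalIdeal (S k n) ^ 2, ρ s = π (X i) - ∑ j, M i j • ρ (X j) := fun i =>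
    exists_of_mem_maximalIdeal_pow hρ (hMX i)
  choose s hs hsρ using this
  refine ⟨u⁻¹, fun i => ∑ j, M i j • X j + s i, h ∘ₗ homogeneousComponent d, ?_, ?_, ?_, ?_, ?_, ?_⟩
  · rw [constantCoeff_inv]
    exact inv_ne_zero hu0
  · intro i
    rw [map_add, ← coeff_zero_eq_constantCoeff_apply (s i),
      coeff_eq_zero_of_mem_maximalIdeal_pow (hs i) (by simp), add_zero, map_sum]
    refine Finset.sum_eq_zero fun j _ => ?_
    simp
  · convert hM
    ext i j
    rw [Matrix.of_apply, map_add, coeff_eq_zero_of_mem_maximalIdeal_pow (hs i) (by simp), map_sum]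
    simp [coeff_X, Finsupp.single_left_inj]
  · intro s
    change h _ = h (homogeneousComponent d (homogeneousComponent d s))
    rw [homogeneousComponent_homogeneousComponent, if_pos rfl]
  · intro h0
    have h1 := LinearMap.congr_fun h0 w
    rw [LinearMap.comp_apply, hFw] at h1
    exact hw0 h1
  · intro a _
    rw [hu, ← mul_assoc, MvPowerSeries.mul_inv_cancel _ hu0, one_mul, hh, ← hfA,
      monomial_one_eq_prod]
    congr 1
    rw [map_prod, map_prod]
    refine Finset.prod_congr rfl fun i _ => ?_
    rw [map_pow, map_pow, map_add, hsρ, map_sum]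
    simp

end

/-! ### Twisted forms are canonically graded -/

section

variable {k : Type*} [Field k] {n : ℕ}

theorem map_mem_pow_of_map_X_mem {φ : S k n →ₐ[k] S k n}
    (hφ : ∀ i, φ (X i) ∈ maximalIdeal (S k n)) {j : ℕ} {s : S k n}
    (hs : s ∈ maximalIdeal (S k n) ^ j) : φ s ∈ maximalIdeal (S k n) ^ j := by
  have h1 : (maximalIdeal (S k n)).map φ ≤ maximalIdeal (S k n) := by
    conv_lhs => rw [maximalIdeal_eq_span]
    rw [Ideal.map_span, Ideal.span_le]
    rintro _ ⟨_, ⟨i, rfl⟩, rfl⟩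
    exact hφ i
  have h2 := Ideal.mem_map_of_mem φ hs
  rw [Ideal.map_pow] at h2
  exact Ideal.pow_right_mono h1 j h2

/-- Inverse function theorem, algebraic part: power series with invertible linear part generate the
maximal ideal. -/
theorem maximalIdeal_eq_span_of_det_ne_zero {b : Fin n → S k n} (hb : ∀ i, constantCoeff (b i) = 0)
    (hdet : (Matrix.of fun i j => coeff (Finsupp.single j 1) (b i)).det ≠ 0) :
    maximalIdeal (S k n) = Ideal.span (Set.range b) := by
  refine le_antisymm ?_ (Ideal.span_le.2 ?_)
  · refine Submodule.le_of_le_smul_of_le_jacobson_bot (I := maximalIdeal (S k n)) ?_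
      (maximalIdeal_le_jacobson _) ?_
    · rw [maximalIdeal_eq_span]
      exact Submodule.fg_span (Set.finite_range _)
    · conv_lhs => rw [maximalIdeal_eq_span]
      rw [Ideal.span_le]
      rintro _ ⟨i, rfl⟩
      let M : Matrix (Fin n) (Fin n) k := Matrix.of fun i j => coeff (Finsupp.single j 1) (b i)
      have hM : M⁻¹ * M = 1 := Matrix.nonsing_inv_mul _ (isUnit_iff_ne_zero.2 hdet)
      have h1 : (X i : S k n) = ∑ j, M⁻¹ i j • b j -
          ∑ j, M⁻¹ i j • (b j - ∑ l, M j l • X l) := by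
        rw [← Finset.sum_sub_distrib]
        simp_rw [← smul_sub, sub_sub_cancel, Finset.smul_sum, smul_smul]
        rw [Finset.sum_comm]
        simp_rw [← Finset.sum_smul, ← Matrix.mul_apply, hM]
        simp [Matrix.one_apply]
      rw [SetLike.mem_coe, h1]
      refine sub_mem (Submodule.mem_sup_left ?_) (Submodule.mem_sup_right ?_)
      · exact Ideal.sum_mem _ fun j _ => Submodule.smul_of_tower_mem _ _ (Ideal.subset_span ⟨j, rfl⟩)
      · rw [smul_eq_mul, ← pow_two]
        exact Ideal.sum_mem _ fun j _ => Submodule.smul_of_tower_mem _ _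
          (sub_sum_linear_mem (mem_maximalIdeal_iff.2 (hb j)))
  · rintro _ ⟨i, rfl⟩
    exact mem_maximalIdeal_iff.2 (hb i)

/-- Surjectivity to every finite order replaces inverting `φ`, since the functionals in play kill `𝔪
^ (d + 1)`. Remove the constant term, expand in the `φ (X i)`, and approximate the coefficients to
one order less. -/
theorem exists_sub_map_mem_pow {φ : S k n →ₐ[k] S k n}
    (hφ : maximalIdeal (S k n) = Ideal.span (Set.range fun i => φ (X i))) (j : ℕ) (s : S k n) :
    ∃ t, s - φ t ∈ maximalIdeal (S k n) ^ j := by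
  induction j generalizing s with
  | zero => simp
  | succ j ih =>
    have h1 : s - algebraMap k (S k n) (constantCoeff s) ∈ maximalIdeal (S k n) := by
      rw [mem_maximalIdeal_iff, map_sub, MvPowerSeries.algebraMap_apply]
      simp
    rw [hφ, Ideal.mem_span_range_iff_exists_fun] at h1
    obtain ⟨q, hq⟩ := h1
    choose t ht using fun i => ih (q i)
    refine ⟨algebraMap k _ (constantCoeff s) + ∑ i, t i * X i, ?_⟩
    have h2 : s - φ (algebraMap k _ (constantCoeff s) + ∑ i, t i * X i) =
        ∑ i, (q i - φ (t i)) * φ (X i) := by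
      simp_rw [sub_mul]
      rw [map_add, AlgHom.commutes, ← sub_sub, ← hq, map_sum, Finset.sum_sub_distrib]
      simp_rw [map_mul]
    rw [h2, pow_succ]
    refine Ideal.sum_mem _ fun i _ => Ideal.mul_mem_mul (ht i) ?_
    rw [hφ]
    exact Ideal.subset_span ⟨i, rfl⟩

theorem homogeneousComponent_mul_left (i j : ℕ) (t s : S k n) :
    homogeneousComponent (i + j) (homogeneousComponent i t * s) =
      homogeneousComponent i t * homogeneousComponent j s := by
  rw [homogeneousComponent_mul, Finset.sum_eq_single (i, j),
    homogeneousComponent_homogeneousComponent, if_pos rfl]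
  · rintro ⟨p, q⟩ hpq hne
    rw [Finset.HasAntidiagonal.mem_antidiagonal] at hpq
    rw [homogeneousComponent_homogeneousComponent, if_neg, zero_mul]
    rintro rfl
    exact hne (Prod.ext rfl (Nat.add_left_cancel hpq))
  · exact fun h => (h (Finset.HasAntidiagonal.mem_antidiagonal.2 rfl)).elim

theorem mem_PLE_of_homogeneous {d : ℕ} {F : Module.Dual k (S k n)}
    (hF : ∀ s, F s = F (homogeneousComponent d s)) : F ∈ PLE k n d := by
  rw [mem_PLE_iff]
  intro s hs
  rw [hF, homogeneousComponent_eq_zero_of_mem d.lt_succ_self hs, map_zero]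

/-- The apolar ideal of a homogeneous functional is homogeneous. -/
theorem mem_Ann_iff_of_homogeneous {d : ℕ} {F : Module.Dual k (S k n)}
    (hF : ∀ s, F s = F (homogeneousComponent d s)) (s : S k n) :
    s ∈ Ann F ↔ ∀ j, homogeneousComponent j s ∈ Ann F := by
  refine ⟨fun hs j => mem_Ann.2 fun t => ?_, fun hs => ?_⟩
  · by_cases hj : j ≤ d
    · obtain ⟨i, rfl⟩ := Nat.exists_eq_add_of_le hj
      -- With `i = d - j`, the value of `F` at `t` times the degree-`j` part of `s` equals its value
      -- at the degree-`i` part of `t` times `s`.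
      rw [hF, add_comm j i, mul_comm, add_comm i j, homogeneousComponent_mul_left, mul_comm,
        ← homogeneousComponent_mul_left, add_comm i j, ← hF]
      exact mem_Ann.1 hs _
    · rw [hF, homogeneousComponent_eq_zero_of_mem (not_le.1 hj)
        (Ideal.mul_mem_left _ t (homogeneousComponent_mem j s)), map_zero]
  · have h1 := maximalIdeal_pow_le_Ann (mem_PLE_of_homogeneous hF)
      (sub_sum_homogeneousComponent_mem (d + 1) s)
    rw [← sub_add_cancel s (∑ i ∈ Finset.range (d + 1), homogeneousComponent i s)]
    exact add_mem h1 (Ideal.sum_mem _ fun i _ => hs i)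

/-- As `u` is a unit and `φ` is onto modulo `𝔪 ^ (d + 1)`, `Ann f` is the preimage of `Ann F`, so
the two apolar algebras are isomorphic. Since `Ann F` is homogeneous, it is also the kernel of the
induced presentation of the associated graded algebra. -/
theorem IsTwistedForm.isCanonicallyGraded {d : ℕ} {f : Module.Dual k (S k n)} (hf : f ∈ PLE k n d)
    (h : IsTwistedForm d f) : ∃ _ : IsLocalRing (Apolar f),
      IsCanonicallyGraded k (Apolar f) ∧ HasSocleDegree (Apolar f) d := by
  obtain ⟨u, b, F, hu, hb, hdet, hF, hF0, hfF⟩ := h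
  let φ : S k n →ₐ[k] S k n := substAlgHom (hasSubst_of_constantCoeff_zero hb)
  have hφX : ∀ i, φ (X i) = b i := substAlgHom_X _
  have hφm : maximalIdeal (S k n) = Ideal.span (Set.range fun i => φ (X i)) := by
    simp_rw [hφX]
    exact maximalIdeal_eq_span_of_det_ne_zero hb hdet
  have hFP := mem_PLE_of_homogeneous hF
  have hfφ : ∀ s, f s = F (u * φ s) := by
    have : f = F ∘ₗ LinearMap.mulLeft k u ∘ₗ φ.toLinearMap := by
      refine PLE_ext hf (mem_PLE_iff.2 fun s hs => mem_PLE_iff.1 hFP _ ?_) fun a => ?_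
      · refine Ideal.mul_mem_left _ _ (map_mem_pow_of_map_X_mem (φ := φ) (fun i => ?_) hs)
        rw [hφX]
        exact mem_maximalIdeal_iff.2 (hb i)
      · rw [hfF a.1 a.2]
        simp only [LinearMap.comp_apply, LinearMap.mulLeft_apply, AlgHom.toLinearMap_apply]
        rw [monomial_one_eq_prod, map_prod]
        simp_rw [map_pow, hφX]
    exact fun s => LinearMap.congr_fun this s
  let ρ : S k n →ₐ[k] Apolar F := (Ideal.Quotient.mkₐ k (Ann F)).comp φ
  have hρ : Function.Surjective ρ := by
    intro x
    obtain ⟨s, rfl⟩ := Ideal.Quotient.mk_surjective x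
    obtain ⟨t, ht⟩ := exists_sub_map_mem_pow hφm (d + 1) s
    exact ⟨t, (Ideal.Quotient.eq.2 (maximalIdeal_pow_le_Ann hFP ht)).symm⟩
  have hker : Ann f = RingHom.ker ρ := by
    ext s
    have h1 : s ∈ RingHom.ker ρ ↔ φ s ∈ Ann F := by
      rw [RingHom.mem_ker]
      exact Ideal.Quotient.eq_zero_iff_mem
    rw [h1, mem_Ann, mem_Ann]
    refine ⟨fun h r => ?_, fun h t => by rw [hfφ, map_mul φ, ← mul_assoc, h]⟩
    obtain ⟨t, ht⟩ := exists_sub_map_mem_pow hφm (d + 1) (u⁻¹ * r)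
    have h2 := mem_PLE_iff.1 hFP _ (Ideal.mul_mem_right (φ s) _ (Ideal.mul_mem_left _ u ht))
    have h3 := h t
    rw [hfφ, map_mul φ, ← mul_assoc] at h3
    rwa [mul_sub, sub_mul, ← mul_assoc, MvPowerSeries.mul_inv_cancel _ hu, one_mul, map_sub, h3,
      sub_zero] at h2
  let e : Apolar f ≃ₐ[k] Apolar F :=
    (Ideal.quotientEquivAlgOfEq k hker).trans (Ideal.quotientKerAlgEquivOfSurjective hρ)
  let π : S k n →ₐ[k] Apolar f :=
    (e.symm : Apolar F →ₐ[k] Apolar f).comp (Ideal.Quotient.mkₐ k (Ann F))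
  have hπ : Function.Surjective π := e.symm.surjective.comp Ideal.Quotient.mk_surjective
  have hπ0 : ∀ s, π s = 0 ↔ s ∈ Ann F := fun s =>
    (map_eq_zero_iff e.symm e.symm.injective).trans Ideal.Quotient.eq_zero_iff_mem
  -- This element shows both that the quotient is not the zero ring and that `𝔪 ^ d ≠ 0` there.
  obtain ⟨w, hw, hw0⟩ : ∃ w ∈ maximalIdeal (S k n) ^ d, F w ≠ 0 := by
    by_contra! hcon
    exact hF0 (LinearMap.ext fun s => by
      rw [hF, hcon _ (homogeneousComponent_mem d s), LinearMap.zero_apply])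
  have hπw : π w ≠ 0 := fun h => hw0 (by simpa using mem_Ann.1 ((hπ0 w).1 h) 1)
  have : Nontrivial (Apolar f) := ⟨⟨_, _, hπw⟩⟩
  have hloc : IsLocalRing (Apolar f) := IsLocalRing.of_surjective' (π : S k n →+* Apolar f) hπ
  have hd1 : maximalIdeal (Apolar f) ^ (d + 1) = ⊥ := by
    rw [eq_bot_iff]
    intro x hx
    obtain ⟨s, hs, rfl⟩ := exists_of_mem_maximalIdeal_pow hπ hx
    exact (hπ0 s).2 (maximalIdeal_pow_le_Ann hFP hs)
  refine ⟨hloc, ?_, fun h => ?_, fun i hi => ?_⟩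
  · obtain ⟨Θ, hΘ, hΘ0⟩ := exists_gr_presentation hπ hd1
    have hhom := mem_Ann_iff_of_homogeneous hF
    have hker' : RingHom.ker π = RingHom.ker Θ := by
      ext s
      rw [RingHom.mem_ker, RingHom.mem_ker, hΘ0, hπ0, hhom]
      refine forall_congr' fun j => ?_
      rw [← hπ0]
      refine ⟨fun h => h ▸ zero_mem _, fun h => ?_⟩
      -- Correcting by `t` of order `j + 1` lands in the homogeneous ideal `Ann F` without changing
      -- the degree-`j` component.
      obtain ⟨t, ht, hts⟩ := exists_of_mem_maximalIdeal_pow hπ h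
      have h1 : homogeneousComponent j s - t ∈ Ann F := by
        rw [← hπ0, map_sub, hts, sub_self]
      have h2 := (hhom _).1 h1 j
      rwa [map_sub, homogeneousComponent_homogeneousComponent, if_pos rfl,
        homogeneousComponent_eq_zero_of_mem j.lt_succ_self ht, sub_zero, ← hπ0] at h2
    exact ⟨(Ideal.quotientKerAlgEquivOfSurjective hπ).symm.trans
      ((Ideal.quotientEquivAlgOfEq k hker').trans (Ideal.quotientKerAlgEquivOfSurjective hΘ))⟩
  · have h1 := map_mem_maximalIdeal_pow hπ hw
    rw [h, Ideal.mem_bot] at h1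
    exact hπw h1
  · by_contra hlt
    exact hi (le_bot_iff.1 (hd1 ▸ Ideal.pow_le_pow_right (by omega)))

theorem mem_canGradedLocus_iff {d : ℕ} {f : PLE k n d} :
    f ∈ canGradedLocus k n d ↔ IsTwistedForm d (f : Module.Dual k (S k n)) :=
  ⟨fun ⟨_, h1, h2⟩ => isTwistedForm_of_algEquiv_gr h1 h2, fun h => h.isCanonicallyGraded f.2⟩

end

/-! ### The Zariski topology in coordinates and Chevalley's theorem -/

section Coordinates

variable {k : Type*} [Field k] {n d : ℕ}

/-- The coordinates of a point of the affine space `P_{≤ d}`. -/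
def coord (v : PLE k n d) (a : Exponent n d) : k :=
  (v : Module.Dual k (S k n)) (monomial a.1 1)

/-- The point of `P_{≤ d}` with given coordinates. -/
def ofCoord (w : Exponent n d → k) : PLE k n d :=
  ∑ a, w a • ⟨dpMonomial k n a.1, Submodule.subset_span ⟨a.1, a.2, rfl⟩⟩

theorem coe_ofCoord_apply (w : Exponent n d → k) (s : S k n) :
    (ofCoord w : Module.Dual k (S k n)) s = ∑ a, w a * coeff a.1 s := by
  rw [ofCoord, AddSubmonoidClass.coe_finsetSum, LinearMap.sum_apply]
  rfl

theorem coord_ofCoord (w : Exponent n d → k) : coord (ofCoord w) = w := by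
  classical
  ext a
  rw [coord, coe_ofCoord_apply]
  simp [coeff_monomial, Subtype.val_inj]

theorem ofCoord_coord (v : PLE k n d) : ofCoord (coord v) = v :=
  Subtype.ext (PLE_ext (ofCoord (coord v)).2 v.2 fun a => congrFun (coord_ofCoord (coord v)) a)

/-- The coordinates as linear functionals. -/
def coordFunctional (k : Type*) [Field k] {n d : ℕ} (a : Exponent n d) :
    Module.Dual k (PLE k n d) where
  toFun v := coord v a
  map_add' _ _ := rfl
  map_smul' _ _ := rfl

theorem isOpen_eval_coord_ne_zero (p : MvPolynomial (Exponent n d) k) :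
    IsOpen {v : PLE k n d | MvPolynomial.eval (coord v) p ≠ 0} := by
  refine TopologicalSpace.isOpen_generateFrom_of_mem
    ⟨MvPolynomial.rename (coordFunctional k) p, ?_⟩
  simp_rw [MvPolynomial.eval_rename]
  rfl

/-- The defining polynomials involve arbitrary linear functionals; expanding these in the basis
leaves finitely many variables, and products handle intersections. -/
theorem exists_eval_coord_ne_zero {U : Set (PLE k n d)} (hU : IsOpen U) {v : PLE k n d}
    (hv : v ∈ U) : ∃ p : MvPolynomial (Exponent n d) k, MvPolynomial.eval (coord v) p ≠ 0 ∧
      ∀ w, MvPolynomial.eval (coord w) p ≠ 0 → w ∈ U := by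
  induction hU with
  | basic s hs =>
    obtain ⟨p, rfl⟩ := hs
    have key : ∀ w : PLE k n d, MvPolynomial.eval (coord w) (MvPolynomial.bind₁
        (fun l : Module.Dual k (PLE k n d) => ∑ a : Exponent n d, MvPolynomial.X a *
          MvPolynomial.C (l ⟨dpMonomial k n a.1, Submodule.subset_span ⟨a.1, a.2, rfl⟩⟩)) p) =
        MvPolynomial.eval (fun l : Module.Dual k (PLE k n d) => l w) p := by
      intro w
      rw [MvPolynomial.eval, MvPolynomial.eval₂Hom_bind₁]
      congr 2
      ext l
      conv_rhs => rw [← ofCoord_coord w, ofCoord, map_sum]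
      simp
    exact ⟨_, by rw [key]; exact hv, fun w hw => by rw [key] at hw; exact hw⟩
  | univ => exact ⟨1, by simp, fun _ _ => trivial⟩
  | inter s t _ _ hs ht =>
    obtain ⟨p, hp, hp'⟩ := hs hv.1
    obtain ⟨q, hq, hq'⟩ := ht hv.2
    refine ⟨p * q, by rw [map_mul]; exact mul_ne_zero hp hq, fun w hw => ?_⟩
    rw [map_mul] at hw
    exact ⟨hp' w (left_ne_zero_of_mul hw), hq' w (right_ne_zero_of_mul hw)⟩
  | sUnion T _ ih =>
    obtain ⟨s, hs, hvs⟩ := hv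
    obtain ⟨p, hp, hp'⟩ := ih s hs hvs
    exact ⟨p, hp, fun w hw => ⟨s, hs, hp' w hw⟩⟩

/-- Noetherianity and constructibility can thereby be transported from the prime spectrum of the
coordinate ring. -/
theorem isInducing_pointToPoint : Topology.IsInducing fun v : PLE k n d =>
    (MvPolynomial.pointToPoint (coord v) : PrimeSpectrum (MvPolynomial (Exponent n d) k)) := by
  have hbasic : ∀ p : MvPolynomial (Exponent n d) k, (fun v : PLE k n d =>
      (MvPolynomial.pointToPoint (coord v) : PrimeSpectrum (MvPolynomial (Exponent n d) k))) ⁻¹'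
        PrimeSpectrum.basicOpen p = {v | MvPolynomial.eval (coord v) p ≠ 0} := by
    intro p
    ext v
    change ¬ (p ∈ MvPolynomial.vanishingIdeal k {coord v}) ↔ _
    rw [MvPolynomial.mem_vanishingIdeal_singleton_iff]
    simp [MvPolynomial.aeval_eq_eval]
  rw [Topology.isInducing_iff]
  refine le_antisymm (continuous_iff_le_induced.1 ?_) fun U hU => ?_
  · refine PrimeSpectrum.isTopologicalBasis_basic_opens.continuous_iff.2 ?_
    rintro _ ⟨p, rfl⟩
    rw [hbasic]
    exact isOpen_eval_coord_ne_zero p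
  · refine isOpen_induced_iff.2 ⟨⋃ p ∈ {p : MvPolynomial (Exponent n d) k |
      ∀ w : PLE k n d, MvPolynomial.eval (coord w) p ≠ 0 → w ∈ U}, PrimeSpectrum.basicOpen p,
      isOpen_biUnion fun p _ => (PrimeSpectrum.basicOpen p).2, ?_⟩
    rw [Set.preimage_iUnion₂]
    simp_rw [hbasic]
    ext v
    rw [Set.mem_iUnion₂]
    constructor
    · rintro ⟨p, hp, hv⟩
      exact hp v hv
    · intro hv
      obtain ⟨p, hp, hp'⟩ := exists_eval_coord_ne_zero hU hv
      exact ⟨p, hp', hp⟩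

/-- Chevalley's theorem for polynomial maps between affine spaces. -/
theorem isConstructible_polynomial_image [IsAlgClosed k] {τ : Type*} [Finite τ]
    (P : Exponent n d → MvPolynomial τ k) (q : MvPolynomial τ k) :
    Topology.IsConstructible {v : PLE k n d | ∃ y : τ → k, MvPolynomial.eval y q ≠ 0 ∧
      ∀ a, coord v a = MvPolynomial.eval y (P a)} := by
  have : TopologicalSpace.NoetherianSpace (PLE k n d) :=
    isInducing_pointToPoint.noetherianSpace
  let g : MvPolynomial (Exponent n d) k →+* MvPolynomial τ k :=
    (MvPolynomial.bind₁ P : MvPolynomial (Exponent n d) k →ₐ[k] MvPolynomial τ k)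
  have hg : g.FinitePresentation := by
    rw [← RingHom.FinitePresentation.of_finiteType]
    refine RingHom.FiniteType.of_comp_finiteType (f := MvPolynomial.C) ?_
    have h1 : g.comp MvPolynomial.C = algebraMap k (MvPolynomial τ k) := by
      ext x : 1
      exact MvPolynomial.bind₁_C_right P x
    rw [h1, RingHom.finiteType_algebraMap]
    infer_instance
  have h := PrimeSpectrum.isConstructible_comap_image hg
    (PrimeSpectrum.isConstructible_basicOpen (f := q))
  have h2 := h.preimage isInducing_pointToPoint.continuous
    fun s _ _ => fun U _ _ => TopologicalSpace.NoetherianSpace.isCompact _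
  convert h2 using 1
  ext v
  constructor
  · rintro ⟨y, hq, hy⟩
    refine ⟨MvPolynomial.pointToPoint y, ?_, ?_⟩
    · change ¬ (q ∈ MvPolynomial.vanishingIdeal k {y})
      rwa [MvPolynomial.mem_vanishingIdeal_singleton_iff, MvPolynomial.aeval_eq_eval]
    · refine PrimeSpectrum.ext (Ideal.ext fun p => ?_)
      change g p ∈ MvPolynomial.vanishingIdeal k {y} ↔
        p ∈ MvPolynomial.vanishingIdeal k {coord v}
      rw [MvPolynomial.mem_vanishingIdeal_singleton_iff,
        MvPolynomial.mem_vanishingIdeal_singleton_iff, MvPolynomial.aeval_eq_eval,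
        MvPolynomial.aeval_eq_eval, funext hy]
      change MvPolynomial.eval y (MvPolynomial.bind₁ P p) = 0 ↔ _
      rw [MvPolynomial.eval, MvPolynomial.eval₂Hom_bind₁]
      rfl
  · rintro ⟨I, hI, hIv⟩
    replace hIv : PrimeSpectrum.comap g I = MvPolynomial.pointToPoint (coord v) := hIv
    -- Chevalley only yields a prime in the fibre. By the Nullstellensatz its zero locus has a
    -- `k`-point with `q ≠ 0`, which still maps to `v`.
    have hq : q ∉ MvPolynomial.vanishingIdeal k (MvPolynomial.zeroLocus k I.asIdeal) := by
      rw [MvPolynomial.IsPrime.vanishingIdeal_zeroLocus]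
      exact hI
    rw [MvPolynomial.mem_vanishingIdeal_iff] at hq
    push Not at hq
    obtain ⟨y, hy, hqy⟩ := hq
    refine ⟨y, hqy, fun a => ?_⟩
    have h3 : MvPolynomial.X a - MvPolynomial.C (coord v a) ∈
        (MvPolynomial.pointToPoint (k := k) (coord v)).asIdeal := by
      change _ ∈ MvPolynomial.vanishingIdeal k {coord v}
      simp
    rw [← hIv] at h3
    have h4 := hy _ h3
    have h5 : g (MvPolynomial.X a - MvPolynomial.C (coord v a)) =
        P a - MvPolynomial.C (coord v a) := by
      simp [g]
    rw [h5, MvPolynomial.aeval_eq_eval] at h4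
    simp [sub_eq_zero] at h4
    exact h4.symm

end Coordinates

/-! ### Parametrizing twisted forms by an affine space -/

section Parametrization

variable {R : Type*} [CommRing R] {n d e : ℕ}

/-- The power series with given coefficients in degrees at most `e` and no further terms. -/
def truncSeries (w : Exponent n e → R) : MvPowerSeries (Fin n) R :=
  fun a => if h : a.degree ≤ e then w ⟨a, h⟩ else 0

theorem coeff_truncSeries (w : Exponent n e → R) (a : Exponent n e) :
    coeff a.1 (truncSeries w) = w a :=
  dif_pos a.2

theorem map_truncSeries {R' : Type*} [CommRing R'] (φ : R →+* R') (w : Exponent n e → R) :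
    map φ (truncSeries w) = truncSeries fun a => φ (w a) := by
  ext a
  rw [coeff_map]
  change φ (dite _ _ _) = dite _ _ _
  split_ifs with h
  · rfl
  · exact map_zero φ

theorem sub_truncSeries_mem {k : Type*} [Field k] (s : S k n) :
    s - truncSeries (fun a : Exponent n e => coeff a.1 s) ∈ maximalIdeal (S k n) ^ (e + 1) := by
  rw [mem_maximalIdeal_pow_iff]
  intro a ha
  rw [map_sub, coeff_truncSeries _ (⟨a, by omega⟩ : Exponent n e), sub_self]

/-- The indices of the coefficients of a unit, of a homogeneous form and of the components of a change
of coordinates. -/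
abbrev ParamIndex (n d : ℕ) : Type := Option (Option (Fin n)) × Exponent n (d + 1)

/-- The unit with parameters `y`. -/
def unitSeries (y : ParamIndex n d → R) : MvPowerSeries (Fin n) R :=
  truncSeries fun a => y (none, a)

/-- The change of coordinates with parameters `y`. -/
def coordSeries (y : ParamIndex n d → R) (i : Fin n) : MvPowerSeries (Fin n) R :=
  truncSeries fun a => if a.1 = 0 then 0 else y (some (some i), a)

/-- An exponent of degree at most `d`, regarded as an exponent of degree at most `d + 1`. -/
def Exponent.succ (a : Exponent n d) : Exponent n (d + 1) := ⟨a.1, a.2.trans d.le_succ⟩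

/-- The coordinates of the twisted form with parameters `y`. -/
def twistedCoord (y : ParamIndex n d → R) (a : Exponent n d) : R :=
  ∑ c : Exponent n d, if c.1.degree = d then
    y (some none, c.succ) * coeff c.1 (unitSeries y * ∏ i, coordSeries y i ^ a.1 i) else 0

/-- The function whose non-vanishing ensures that the parameters `y` define a twisted form, with
nonzero coefficient of `x ^ [c]`. -/
def paramDisc (c : Exponent n d) (y : ParamIndex n d → R) : R :=
  constantCoeff (unitSeries y) *
    (Matrix.of fun i j => coeff (Finsupp.single j 1) (coordSeries y i)).det *
    y (some none, c.succ)

theorem map_unitSeries {R' : Type*} [CommRing R'] (φ : R →+* R') (y : ParamIndex n d → R) :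
    map φ (unitSeries y) = unitSeries fun x => φ (y x) :=
  map_truncSeries _ _

theorem map_coordSeries {R' : Type*} [CommRing R'] (φ : R →+* R') (y : ParamIndex n d → R)
    (i : Fin n) : map φ (coordSeries y i) = coordSeries (fun x => φ (y x)) i := by
  rw [coordSeries, map_truncSeries, coordSeries]
  congr 1
  ext a
  rw [apply_ite φ, map_zero]

/-- Naturality in the ring: evaluating the construction at generic parameters shows that the
coordinates are polynomial functions of the parameters. -/
theorem map_twistedCoord {R' : Type*} [CommRing R'] (φ : R →+* R') (y : ParamIndex n d → R)
    (a : Exponent n d) : φ (twistedCoord y a) = twistedCoord (fun x => φ (y x)) a := by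
  rw [twistedCoord, map_sum, twistedCoord]
  refine Finset.sum_congr rfl fun c _ => ?_
  rw [apply_ite φ, map_zero, map_mul, ← coeff_map, map_mul, map_prod, map_unitSeries]
  simp_rw [map_pow, map_coordSeries]

theorem map_paramDisc {R' : Type*} [CommRing R'] (φ : R →+* R') (c : Exponent n d)
    (y : ParamIndex n d → R) : φ (paramDisc c y) = paramDisc c fun x => φ (y x) := by
  rw [paramDisc, map_mul, map_mul, RingHom.map_det, paramDisc, ← constantCoeff_map, map_unitSeries]
  congr 3
  ext i j
  simp only [RingHom.mapMatrix_apply, Matrix.map_apply, Matrix.of_apply]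
  rw [← coeff_map, map_coordSeries]

end Parametrization

/-! ### Constructibility and irreducibility -/

section

variable {k : Type*} [Field k] {n d : ℕ}

/-- `F` sees only degree `d`, so `u` and the `b i` may be truncated; `F ≠ 0` means that some
coefficient, indexed by `c`, is nonzero. -/
theorem isTwistedForm_iff {f : PLE k n d} :
    IsTwistedForm d (f : Module.Dual k (S k n)) ↔ ∃ c : Exponent n d, c.1.degree = d ∧
      ∃ y : ParamIndex n d → k, paramDisc c y ≠ 0 ∧ ∀ a, coord f a = twistedCoord y a := by
  classical
  constructor
  · rintro ⟨u, b, F, hu, hb, hdet, hF, hF0, hfF⟩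
    have hFP := mem_PLE_of_homogeneous hF
    have hFlow : ∀ a : Fin n →₀ ℕ, a.degree ≠ d → F (monomial a 1) = 0 := by
      intro a ha
      rw [hF, ← map_zero F]
      congr 1
      ext c
      rw [coeff_homogeneousComponent, coeff_monomial, map_zero]
      split_ifs with h1 h2
      · exact absurd (h2 ▸ h1) ha
      · rfl
      · rfl
    obtain ⟨c, hc⟩ : ∃ c : Exponent n d, F (monomial c.1 1) ≠ 0 := by
      by_contra! h
      exact hF0 (PLE_ext hFP (zero_mem _) h)
    have hFsum : ∀ s, F s = ∑ c : Exponent n d, if c.1.degree = d then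
        F (monomial c.1 1) * coeff c.1 s else 0 := by
      intro s
      rw [apply_eq_sum (mem_PLE_iff.1 hFP)]
      refine Finset.sum_congr rfl fun a _ => ?_
      split_ifs with h
      · exact mul_comm _ _
      · rw [hFlow _ h, mul_zero]
    let y : ParamIndex n d → k := fun x => x.1.elim (coeff x.2.1 u)
      fun o => o.elim (F (monomial x.2.1 1)) fun i => coeff x.2.1 (b i)
    have hyu : unitSeries y = truncSeries fun a : Exponent n (d + 1) => coeff a.1 u := rfl
    have hyb : ∀ i, coordSeries y i =
        truncSeries fun a : Exponent n (d + 1) => coeff a.1 (b i) := by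
      intro i
      rw [coordSeries]
      congr 1
      ext a
      split_ifs with h
      · rw [h, coeff_zero_eq_constantCoeff_apply, hb]
      · rfl
    refine ⟨c, not_imp_comm.1 (hFlow c.1) hc, y, ?_, fun a => ?_⟩
    · rw [paramDisc]
      refine mul_ne_zero (mul_ne_zero ?_ ?_) hc
      · rw [hyu, ← coeff_zero_eq_constantCoeff_apply,
          coeff_truncSeries _ (⟨0, by simp⟩ : Exponent n (d + 1))]
        exact hu
      · convert hdet using 2
        ext i j
        -- Parameters run up to degree `d + 1`, so linear coefficients are present even when `d =
        -- 0`.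
        rw [Matrix.of_apply, Matrix.of_apply, hyb, coeff_truncSeries _ (⟨Finsupp.single j 1, by simp⟩ : Exponent n (d + 1))]
    · rw [coord, hfF a.1 a.2, hFsum, twistedCoord]
      refine Finset.sum_congr rfl fun c _ => if_congr Iff.rfl (congrArg _ ?_) rfl
      rw [← sub_eq_zero, ← map_sub]
      refine coeff_eq_zero_of_mem_maximalIdeal_pow (j := d + 1 + 1) ?_ (by have := c.2; omega)
      rw [← Ideal.Quotient.eq, map_mul, map_mul, map_prod, map_prod]
      simp_rw [map_pow]
      rw [Ideal.Quotient.eq.2 (sub_truncSeries_mem (e := d + 1) u), hyu]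
      simp_rw [hyb, fun i => Ideal.Quotient.eq.2 (sub_truncSeries_mem (e := d + 1) (b i))]
  · rintro ⟨c, hc, y, hy, hfy⟩
    rw [paramDisc] at hy
    let F : Module.Dual k (S k n) := ∑ c : Exponent n d,
      if c.1.degree = d then y (some none, c.succ) • coeff c.1 else 0
    have hF : ∀ s, F s = ∑ c : Exponent n d, if c.1.degree = d then
        y (some none, c.succ) * coeff c.1 s else 0 := by
      intro s
      rw [LinearMap.sum_apply]
      refine Finset.sum_congr rfl fun c _ => ?_
      split_ifs <;> rfl
    refine ⟨unitSeries y, coordSeries y, F, left_ne_zero_of_mul (left_ne_zero_of_mul hy), fun i => ?_,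
      right_ne_zero_of_mul (left_ne_zero_of_mul hy), fun s => ?_, fun h => ?_, fun a ha => ?_⟩
    · rw [coordSeries, ← coeff_zero_eq_constantCoeff_apply,
        coeff_truncSeries _ (⟨0, by simp⟩ : Exponent n (d + 1)), if_pos rfl]
    · rw [hF, hF]
      refine Finset.sum_congr rfl fun c _ => if_ctx_congr Iff.rfl (fun h => ?_) fun _ => rfl
      rw [coeff_homogeneousComponent, if_pos h]
    · have h1 := hF (monomial c.1 1)
      rw [h, LinearMap.zero_apply, Finset.sum_eq_single c, if_pos hc, coeff_monomial, if_pos rfl,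
        mul_one] at h1
      · exact right_ne_zero_of_mul hy h1.symm
      · intro b _ hb
        rw [coeff_monomial, if_neg (fun h => hb (Subtype.ext h)), mul_zero, ite_self]
      · simp
    · rw [hF]
      exact hfy ⟨a, ha⟩

/-- The generic parameters. -/
abbrev genericParam (k : Type*) [Field k] (n d : ℕ) :
    ParamIndex n d → MvPolynomial (ParamIndex n d) k := MvPolynomial.X

theorem eval_twistedCoord (y : ParamIndex n d → k) (a : Exponent n d) :
    MvPolynomial.eval y (twistedCoord (genericParam k n d) a) = twistedCoord y a := by
  rw [map_twistedCoord]
  simp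

theorem eval_paramDisc (y : ParamIndex n d → k) (c : Exponent n d) :
    MvPolynomial.eval y (paramDisc c (genericParam k n d)) = paramDisc c y := by
  rw [map_paramDisc]
  simp

theorem eval_bind₁_twistedCoord (y : ParamIndex n d → k) (p : MvPolynomial (Exponent n d) k) :
    MvPolynomial.eval y (MvPolynomial.bind₁ (twistedCoord (genericParam k n d)) p) =
      MvPolynomial.eval (twistedCoord y) p := by
  rw [MvPolynomial.eval, MvPolynomial.eval₂Hom_bind₁]
  congr 2
  ext a
  exact eval_twistedCoord y a

theorem isConstructible_canGradedLocus [IsAlgClosed k] :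
    Topology.IsConstructible (canGradedLocus k n d) := by
  have : canGradedLocus k n d = ⋃ c ∈ {c : Exponent n d | c.1.degree = d},
      {v : PLE k n d | ∃ y : ParamIndex n d → k,
        MvPolynomial.eval y (paramDisc c (genericParam k n d)) ≠ 0 ∧
        ∀ a, coord v a = MvPolynomial.eval y (twistedCoord (genericParam k n d) a)} := by
    ext f
    simp_rw [mem_canGradedLocus_iff, isTwistedForm_iff, Set.mem_iUnion₂, eval_twistedCoord,
      eval_paramDisc]
    simp only [Set.mem_ofPred_eq, exists_prop]
  rw [this]
  exact Topology.IsConstructible.biUnion (Set.toFinite _) fun c _ =>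
    isConstructible_polynomial_image _ _

/-- Polynomials cutting out two neighbourhoods that meet the locus pull back to nonzero polynomials
in the parameters. Their product with both discriminants is nonzero, hence nonzero at some
parameter, whose twisted form lies in both neighbourhoods. -/
theorem isPreirreducible_canGradedLocus [Infinite k] : IsPreirreducible (canGradedLocus k n d) := by
  have key : ∀ f ∈ canGradedLocus k n d, ∀ p : MvPolynomial (Exponent n d) k,
      MvPolynomial.eval (coord f) p ≠ 0 → ∃ c : Exponent n d, c.1.degree = d ∧
        paramDisc c (genericParam k n d) *
          MvPolynomial.bind₁ (twistedCoord (genericParam k n d)) p ≠ 0 := by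
    intro f hf p hp
    rw [mem_canGradedLocus_iff, isTwistedForm_iff] at hf
    obtain ⟨c, hc, y, hy, hfy⟩ := hf
    refine ⟨c, hc, fun h => ?_⟩
    have h1 := congrArg (MvPolynomial.eval y) h
    rw [map_mul, eval_paramDisc, map_zero] at h1
    refine mul_ne_zero hy ?_ h1
    rwa [eval_bind₁_twistedCoord, ← funext hfy]
  rintro U V hU hV ⟨f, hf, hfU⟩ ⟨g, hg, hgV⟩
  obtain ⟨p, hp, hpU⟩ := exists_eval_coord_ne_zero hU hfU
  obtain ⟨q, hq, hqV⟩ := exists_eval_coord_ne_zero hV hgV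
  obtain ⟨c, hc, hc0⟩ := key f hf p hp
  obtain ⟨c', -, hc0'⟩ := key g hg q hq
  obtain ⟨y, hy⟩ : ∃ y, MvPolynomial.eval y (paramDisc c (genericParam k n d) *
      MvPolynomial.bind₁ (twistedCoord (genericParam k n d)) p *
      (paramDisc c' (genericParam k n d) *
        MvPolynomial.bind₁ (twistedCoord (genericParam k n d)) q)) ≠ 0 := by
    by_contra! h
    exact mul_ne_zero hc0 hc0' (MvPolynomial.funext fun y => by rw [h, map_zero])
  rw [map_mul, map_mul, map_mul] at hy
  rw [eval_bind₁_twistedCoord, eval_bind₁_twistedCoord, eval_paramDisc,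
    ← coord_ofCoord (twistedCoord y)] at hy
  refine ⟨ofCoord (twistedCoord y), ?_, hpU _ ?_, hqV _ ?_⟩
  · rw [mem_canGradedLocus_iff, isTwistedForm_iff]
    exact ⟨c, hc, y, left_ne_zero_of_mul (left_ne_zero_of_mul hy), fun a => by rw [coord_ofCoord]⟩
  · exact right_ne_zero_of_mul (left_ne_zero_of_mul hy)
  · exact right_ne_zero_of_mul (right_ne_zero_of_mul hy)

end

/-! ### The explicit binary forms -/

section

variable {k : Type*} [Field k]

theorem isTwistedForm_of_contract {n d : ℕ} {f F : Module.Dual k (S k n)} {u : S k n}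
    (hu : constantCoeff u ≠ 0) (hF : ∀ s, F s = F (homogeneousComponent d s)) (hF0 : F ≠ 0)
    (hf : ∀ s, f s = F (u * s)) : IsTwistedForm d f := by
  refine ⟨u, X, F, hu, fun i => constantCoeff_X i, ?_, hF, hF0, fun a _ => ?_⟩
  · classical
    have : (Matrix.of fun i j : Fin n => coeff (Finsupp.single j 1) (X i : S k n)) = 1 := by
      ext i j
      simp [coeff_X, Finsupp.single_left_inj, Matrix.one_apply, eq_comm]
    rw [this, Matrix.det_one]
    exact one_ne_zero
  · rw [hf, monomial_one_eq_prod]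

theorem coeff_apply_homogeneousComponent {n : ℕ} (a : Fin n →₀ ℕ) (s : S k n) :
    coeff a s = coeff a (homogeneousComponent a.degree s) := by
  rw [coeff_homogeneousComponent, if_pos rfl]

theorem isTwistedForm_dpMonomial {n d : ℕ} {a : Fin n →₀ ℕ} (ha : a.degree = d) :
    IsTwistedForm d (dpMonomial k n a) := by
  refine isTwistedForm_of_contract (u := 1) (F := dpMonomial k n a) (by simp)
    (ha ▸ coeff_apply_homogeneousComponent a) (fun h => ?_) fun s => by rw [one_mul]
  classical
  have h1 := LinearMap.congr_fun h (monomial a 1)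
  rw [dpMonomial, coeff_monomial_same] at h1
  exact one_ne_zero h1

/-- The binary form `x ^ [d] + s y ^ [d]` twisted by the unit `1 + s⁻¹ β`. -/
theorem isTwistedForm_add_smul {d : ℕ} (hd : d ≠ 0) {s : k} (hs : s ≠ 0) :
    IsTwistedForm d (dpMonomial k 2 (Finsupp.single 0 d) +
      dpMonomial k 2 (Finsupp.single 1 (d - 1)) + s • dpMonomial k 2 (Finsupp.single 1 d)) := by
  classical
  obtain ⟨e, rfl⟩ := Nat.exists_eq_succ_of_ne_zero hd
  refine isTwistedForm_of_contract (u := 1 + s⁻¹ • X 1)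
    (F := dpMonomial k 2 (Finsupp.single 0 (e + 1)) + s • dpMonomial k 2 (Finsupp.single 1 (e + 1)))
    (by simp) (fun t => ?_) (fun h => ?_) fun t => ?_
  · simp [dpMonomial, coeff_homogeneousComponent]
  · have h1 := LinearMap.congr_fun h (monomial (Finsupp.single 0 (e + 1)) 1)
    rw [LinearMap.add_apply, LinearMap.smul_apply, dpMonomial, dpMonomial, coeff_monomial_same,
      coeff_monomial_ne, smul_zero, add_zero] at h1
    · exact one_ne_zero h1
    · rw [Ne, Finsupp.single_eq_single_iff]
      simp
  · have h0 : coeff (Finsupp.single 0 (e + 1)) ((X 1 : S k 2) * t) = 0 := by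
      rw [X, coeff_monomial_mul, if_neg]
      intro h
      have := h 1
      simp at this
    have h1 : coeff (Finsupp.single 1 (e + 1)) ((X 1 : S k 2) * t) =
        coeff (Finsupp.single 1 e) t := by
      rw [add_comm e, Finsupp.single_add, X, coeff_add_monomial_mul, one_mul]
    rw [add_mul, one_mul, smul_mul_assoc, map_add, map_smul]
    simp only [dpMonomial, LinearMap.add_apply, LinearMap.smul_apply, smul_eq_mul, h0, h1,
      Nat.succ_eq_add_one, Nat.add_sub_cancel]
    field_simp
    ring

/-- `f` vanishes on the degree-`d` monomials involving the second variable, so `F` kills `b 1 * 𝔪 ^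
(d - 1)`. By homogeneity it kills every multiple of the linear part `q` of `b 1`. Modulo `q`, `b 1`
has order at least two, so its power `d - 1` contributes nothing, whereas `F (u * b 1 ^ (d - 1))`
should equal `t`. -/
theorem not_isTwistedForm_add_smul {d : ℕ} (hd : 3 ≤ d) {t : k} (ht : t ≠ 0) :
    ¬ IsTwistedForm d (dpMonomial k 2 (Finsupp.single 0 d) +
      t • dpMonomial k 2 (Finsupp.single 1 (d - 1))) := by
  classical
  rintro ⟨u, b, F, hu, hb, hdet, hF, hF0, hfF⟩
  have hbm : ∀ i, b i ∈ maximalIdeal (S k 2) := fun i => mem_maximalIdeal_iff.2 (hb i)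
  have hFP := mem_PLE_iff.1 (mem_PLE_of_homogeneous hF)
  have hval : ∀ i j, i + j ≤ d → F (u * (b 0 ^ i * b 1 ^ j)) =
      (if i = d ∧ j = 0 then 1 else 0) + t * if i = 0 ∧ j = d - 1 then 1 else 0 := by
    intro i j hij
    have h1 := hfF (Finsupp.single 0 i + Finsupp.single 1 j) (by simpa using hij)
    rw [Fin.prod_univ_two] at h1
    simp only [Finsupp.add_apply, Finsupp.single_apply] at h1
    simp only [zero_ne_one, one_ne_zero, if_true, if_false, add_zero, zero_add] at h1
    rw [← h1, LinearMap.add_apply, LinearMap.smul_apply, dpMonomial, dpMonomial, coeff_monomial,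
      coeff_monomial, smul_eq_mul]
    refine congrArg₂ (· + ·) (if_congr ?_ rfl rfl) (congrArg (t * ·) (if_congr ?_ rfl rfl)) <;>
    · rw [DFunLike.ext_iff, Fin.forall_fin_two]
      simp [eq_comm]
  -- `F` kills the multiples of the second coordinate in degree `d`
  have hkill : ∀ m i j, i + (j + 1) + m = d → ∀ w ∈ maximalIdeal (S k 2) ^ m,
      F (u * (b 0 ^ i * b 1 ^ (j + 1)) * w) = 0 := by
    intro m
    induction m with
    | zero =>
      intro i j hij w _
      have h1 : u * (b 0 ^ i * b 1 ^ (j + 1)) * (w - algebraMap k _ (constantCoeff w)) ∈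
          maximalIdeal (S k 2) ^ (d + 1) := by
        rw [pow_succ]
        refine Ideal.mul_mem_mul (Ideal.mul_mem_left _ _ ?_) ?_
        · rw [← hij, add_zero, pow_add]
          exact Ideal.mul_mem_mul (Ideal.pow_mem_pow (hbm 0) _) (Ideal.pow_mem_pow (hbm 1) _)
        · rw [mem_maximalIdeal_iff, map_sub, MvPowerSeries.algebraMap_apply]
          simp
      have h2 := hFP _ h1
      rw [mul_sub, map_sub, sub_eq_zero] at h2
      rw [h2, mul_comm _ (algebraMap _ _ _), ← Algebra.smul_def, map_smul, hval _ _ (by omega),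
        if_neg (by omega), if_neg (by omega)]
      simp
    | succ m ih =>
      intro i j hij w hw
      rw [pow_succ] at hw
      refine Submodule.mul_induction_on hw (fun w₁ hw₁ w₂ hw₂ => ?_) fun x y hx hy => by
        rw [mul_add, map_add, hx, hy, add_zero]
      -- The `b i` generate the maximal ideal, so one factor of `w` can be traded for a higher
      -- exponent of `b 0` or `b 1`.
      rw [maximalIdeal_eq_span_of_det_ne_zero hb hdet, Ideal.mem_span_range_iff_exists_fun] at hw₂
      obtain ⟨c, rfl⟩ := hw₂
      rw [Fin.sum_univ_two]
      have h1 : u * (b 0 ^ i * b 1 ^ (j + 1)) * (w₁ * (c 0 * b 0 + c 1 * b 1)) =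
          u * (b 0 ^ (i + 1) * b 1 ^ (j + 1)) * (c 0 * w₁) +
          u * (b 0 ^ i * b 1 ^ (j + 1 + 1)) * (c 1 * w₁) := by ring
      rw [h1, map_add, ih (i + 1) j (by omega) _ (Ideal.mul_mem_left _ _ hw₁),
        ih i (j + 1) (by omega) _ (Ideal.mul_mem_left _ _ hw₁), add_zero]
  let q := homogeneousComponent 1 (b 1)
  have hq : b 1 - q ∈ maximalIdeal (S k 2) ^ 2 := by
    have h1 := sub_sum_homogeneousComponent_mem 2 (b 1)
    rwa [Finset.sum_range_succ, Finset.sum_range_one, homogeneousComponent_eq_zero_of_mem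
      (i := 0) (j := 1) one_pos (by simpa using hbm 1), zero_add] at h1
  have hqF : ∀ w ∈ maximalIdeal (S k 2) ^ (d - 1), F (q * w) = 0 := by
    intro w hw
    have h1 := hkill (d - 1) 0 0 (by omega) (u⁻¹ * w) (Ideal.mul_mem_left _ _ hw)
    have h2 : u * (b 0 ^ 0 * b 1 ^ (0 + 1)) * (u⁻¹ * w) = (u * u⁻¹) * (b 1 * w) := by ring
    rw [h2, MvPowerSeries.mul_inv_cancel _ hu, one_mul] at h1
    have h3 : (b 1 - q) * w ∈ maximalIdeal (S k 2) ^ (d + 1) := by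
      rw [show d + 1 = 2 + (d - 1) by omega, pow_add]
      exact Ideal.mul_mem_mul hq hw
    have h4 := hFP _ h3
    rwa [sub_mul, map_sub, h1, zero_sub, neg_eq_zero] at h4
  have hqF' : ∀ w, F (q * w) = 0 := by
    intro w
    rw [hF]
    have h1 := homogeneousComponent_mul_left 1 (d - 1) (b 1) w
    rw [show 1 + (d - 1) = d by omega] at h1
    rw [h1]
    exact hqF _ (homogeneousComponent_mem _ _)
  have hfin := hval 0 (d - 1) (by omega)
  rw [if_neg (by omega), if_pos ⟨rfl, rfl⟩, pow_zero, one_mul, zero_add, mul_one] at hfin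
  obtain ⟨c, hc⟩ : q ∣ b 1 ^ (d - 1) - (b 1 - q) ^ (d - 1) := by
    have := sub_dvd_pow_sub_pow (b 1) (b 1 - q) (d - 1)
    rwa [sub_sub_cancel] at this
  have h5 : u * (b 1 - q) ^ (d - 1) ∈ maximalIdeal (S k 2) ^ (d + 1) := by
    -- `2 * (d - 1) ≥ d + 1` is exactly the condition `d ≥ 3`.
    refine Ideal.mul_mem_left _ _ (Ideal.pow_le_pow_right (n := 2 * (d - 1)) (by omega) ?_)
    rw [pow_mul]
    exact Ideal.pow_mem_pow hq _
  rw [sub_eq_iff_eq_add] at hc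
  rw [hc, mul_add, map_add, hFP _ h5, add_zero, mul_left_comm, hqF'] at hfin
  exact ht hfin.symm

end

/-! ### Limits along lines -/

section Lines

variable {k : Type*} [Field k] [Infinite k] {n d : ℕ}

/-- A Zariski neighbourhood of `v` contains a further point of each line through `v`. -/
theorem exists_add_smul_mem {U : Set (PLE k n d)} (hU : IsOpen U) {v : PLE k n d} (hv : v ∈ U)
    (w : PLE k n d) : ∃ s : k, s ≠ 0 ∧ v + s • w ∈ U := by
  obtain ⟨p, hp, hpU⟩ := exists_eval_coord_ne_zero hU hv
  let P : Polynomial k := MvPolynomial.aeval (fun a => Polynomial.C (coord v a) +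
    Polynomial.X * Polynomial.C (coord w a)) p
  have hP : ∀ s, P.eval s = MvPolynomial.eval (coord (v + s • w)) p := by
    intro s
    have h1 : (Polynomial.evalRingHom s).comp ((MvPolynomial.aeval (R := k)
        (fun a => Polynomial.C (coord v a) + Polynomial.X * Polynomial.C (coord w a)) :
        MvPolynomial (Exponent n d) k →ₐ[k] Polynomial k) :
        MvPolynomial (Exponent n d) k →+* Polynomial k) =
        MvPolynomial.eval (coord (v + s • w)) := by
      ext a
      · simp
      · simp [coord, mul_comm s]
    exact RingHom.congr_fun h1 p
  -- The factor `X` excludes the parameter `s = 0`.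
  have hP0 : Polynomial.X * P ≠ 0 := by
    refine mul_ne_zero Polynomial.X_ne_zero fun h => hp ?_
    have := hP 0
    rwa [h, Polynomial.eval_zero, zero_smul, add_zero, eq_comm] at this
  obtain ⟨s, hs⟩ : ∃ s, (Polynomial.X * P).eval s ≠ 0 := by
    by_contra! h
    exact hP0 (Polynomial.funext fun s => by rw [h, Polynomial.eval_zero])
  rw [Polynomial.eval_mul, Polynomial.eval_X, hP] at hs
  exact ⟨s, left_ne_zero_of_mul hs, hpU _ (right_ne_zero_of_mul hs)⟩

theorem mem_closure_of_line {G : Set (PLE k n d)} {v w : PLE k n d}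
    (h : ∀ s : k, s ≠ 0 → v + s • w ∈ G) : v ∈ closure G := by
  refine mem_closure_iff.2 fun U hU hv => ?_
  obtain ⟨s, hs, hsU⟩ := exists_add_smul_mem hU hv w
  exact ⟨_, hsU, h s hs⟩

end Lines

end CanonicallyGraded

end

open CanonicallyGraded in
theorem mainTheorem8 (k : Type*) [Field k] [IsAlgClosed k] (n d : ℕ) (hn : 1 ≤ n)
    (hchar : ringChar k = 0 ∨ d < ringChar k) :
    IsIrreducible (CanonicallyGraded.canGradedLocus k n d) ∧
    Topology.IsConstructible (CanonicallyGraded.canGradedLocus k n d) ∧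
    (n = 2 → d = 5 →
      ¬ IsClosed (CanonicallyGraded.canGradedLocus k n d) ∧
      ∃ f : CanonicallyGraded.PLE k n d,
        (f : Module.Dual k (CanonicallyGraded.S k n)) ∉ CanonicallyGraded.PLE k n 4 ∧
        f ∈ closure (CanonicallyGraded.canGradedLocus k n d) ∧
        f ∉ CanonicallyGraded.canGradedLocus k n d) ∧
    (n = 2 → 9 ≤ d → ¬ IsOpen (CanonicallyGraded.canGradedLocus k n d)) := by
  have hinf : Infinite k := inferInstance
  let dp : ∀ a : Fin n →₀ ℕ, a.degree ≤ d → PLE k n d := fun a ha =>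
    ⟨dpMonomial k n a, Submodule.subset_span ⟨a, ha, rfl⟩⟩
  refine ⟨⟨⟨dp (Finsupp.single ⟨0, hn⟩ d) (by simp), ?_⟩, isPreirreducible_canGradedLocus⟩,
    isConstructible_canGradedLocus, ?_, ?_⟩
  · exact mem_canGradedLocus_iff.2 (isTwistedForm_dpMonomial (by simp))
  · rintro rfl rfl
    let f := dp (Finsupp.single 0 5) (by simp) + dp (Finsupp.single 1 4) (by simp)
    have h4 : (f : Module.Dual k (S k 2)) ∉ PLE k 2 4 := by
      intro h
      have h1 := apply_eq_zero_of_mem_PLE h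
        (s := MvPowerSeries.monomial (Finsupp.single 0 5) 1) (mem_maximalIdeal_pow_iff.2 ?_)
      · classical
        change MvPowerSeries.coeff _ _ + MvPowerSeries.coeff _ _ = (0 : k) at h1
        rw [MvPowerSeries.coeff_monomial_same, MvPowerSeries.coeff_monomial_ne, add_zero] at h1
        · exact one_ne_zero h1
        · simp [Finsupp.single_eq_single_iff]
      · intro a ha
        classical
        rw [MvPowerSeries.coeff_monomial, if_neg]
        rintro rfl
        simp at ha
    have hcl : f ∈ closure (canGradedLocus k 2 5) :=
      -- Every point other than `f` on the line through `f = x^[5] + y^[4]` in direction `y^[5]` is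
      -- a twisted form.
      mem_closure_of_line (w := dp (Finsupp.single 1 5) (by simp)) fun s hs =>
        mem_canGradedLocus_iff.2 (isTwistedForm_add_smul (by norm_num) hs)
    have hnot : f ∉ canGradedLocus k 2 5 := by
      rw [mem_canGradedLocus_iff]
      have h1 := not_isTwistedForm_add_smul (k := k) (d := 5) (by norm_num) one_ne_zero
      rwa [one_smul] at h1
    exact ⟨fun h => hnot (h.closure_eq ▸ hcl), f, h4, hcl, hnot⟩
  · rintro rfl hd hopen
    -- A neighbourhood of `x^[d]` contains some `x^[d] + t y^[d-1]` with `t ≠ 0`, which is outside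
    -- the locus.
    obtain ⟨t, ht, h⟩ := exists_add_smul_mem hopen
      (v := dp (Finsupp.single 0 d) (by simp))
      (mem_canGradedLocus_iff.2 (isTwistedForm_dpMonomial (by simp)))
      (dp (Finsupp.single 1 (d - 1)) (by rw [Finsupp.degree_single]; omega))
    exact not_isTwistedForm_add_smul (by omega) ht (mem_canGradedLocus_iff.1 h)
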